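/- Let $G$ be a finite group, written additively, with $2^l$ elements ($l\ge 1$). Let $X=Y+Z$, with $Y$ uniform on $G$ and $Z\sim p$ independent of $Y$, let $q$ be a probability distribution on $G$, and let $0\le D\le 1$. Entropies $H$ are in bits, $q\ast d$ denotes convolution, and for $0\le D'\le 1$ let $d_{D'}$ be the distribution on $G$ with $d_{D'}(0)=1-D'$ and $d_{D'}(g)=\frac{D'}{2^l-1}$ for $g\ne 0$; put $d=d_D$. For each block length $n$, two codes $\mathcal C_0,\mathcal C_1$ of $M_0(n),M_1(n)\ge 1$ codewords in $G^n$ are drawn independently of each other and of the source, all letters of all codewords being i.i.d., uniform on $G$ for $\mathcal C_0$ and with law $q$ for $\mathcal C_1$; the rates are $R_i=\lim_n \frac1n\log_2 M_i(n)$. The source word $x^n$ consists of $n$ i.i.d. copies of $X$. Call $(x^n,w^n)$ jointly $\varepsilon$-typical at level $D'$ if it is strongly jointly typical with respect to the law $P_{D'}(x,\hat x)=P_X(x)\,d_{D'}(-x+\hat x)$: with $N(a,b)$ the number of positions at which $(x^n,w^n)$ shows $(a,b)$, one has $|N(a,b)/n-P_{D'}(a,b)|<\varepsilon/|G|^2$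 if $P_{D'}(a,b)>0$, and $N(a,b)=0$ if $P_{D'}(a,b)=0$. A typical encoder with parameters $(D',\varepsilon)$ is any (possibly randomized) rule which, given $x^n$ and the codes, selects $(c_0^n,c_1^n)\in\mathcal C_0\times\mathcal C_1$ with $(x^n,c_0^n+c_1^n)$ jointly $\varepsilon$-typical at level $D'$ if there is such a pair, and otherwise a uniformly random pair. With respect to the constraint $t$ there is an encoder error if $\frac1n d_H(x^n,c_0^n+c_1^n)>t$, where $d_H$ is the Hamming distance; its probability is taken over the source, the codes and the encoder. Suppose that $$R_0>l-H(q\ast d),\qquad R_0+R_1>R_{\mathcal U}(D):=H(X)-H(d).$$ Then: 1. There is $\varepsilon_0>0$ such that for all $0<\varepsilon<\varepsilon_0$ and every sequence of typical encoders with parameters $(\max(0,D-\varepsilon),\varepsilon)$, the probability of an encoder error with respect to the constraint $D$ vanishes as $n\to\infty$. 2. For every $\varepsilon>0$ and every sequence of typical encoders with parameters $(D,\varepsilon)$, the probability of an encoder error with respect to the constraint $D+\varepsilon$ vanishes as $n\to\infty$; and there is a sequence of typical encoders with parameters $(D,\varepsilon)$ for which the probability of an encoder error with respect to the constraint $D$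 itself vanishes. Moreover, if $D\le 1-2^{-l}$, then $R_{\mathcal U}(D)$ is the Hamming-distortion rate-distortion function at $D$ of the uniform source $X$, i.e. the minimum of $I(X;\hat X)$ over all joint laws of $(X,\hat X)$ on $G\times G$ with $X$ distributed as the source and $\Pr(X\ne\hat X)\le D$. -/

import Mathlib

open Filter Topology

namespace SuperpositionCoding

/-- Shannon entropy, in bits, of a probability vector on a finite alphabet. -/
noncomputable def entropy {α : Type*} [Fintype α] (p : α → ℝ) : ℝ :=
  ∑ a, Real.negMulLog (p a) / Real.log 2

/-- The uniform distribution on a finite alphabet. -/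
noncomputable def uniform (α : Type*) [Fintype α] : α → ℝ :=
  fun _ => 1 / (Fintype.card α : ℝ)

/-- The convolution `p ∗ q`: the law of `A + B` for independent `A ∼ p` and `B ∼ q`. -/
def conv {G : Type*} [AddGroup G] [Fintype G] (p q : G → ℝ) : G → ℝ :=
  fun g => ∑ a, p a * q (-a + g)

/-- The law of the source `X = Y + Z`, with `Y` uniform and `Z ∼ p` independent of `Y`. -/
noncomputable def sourceLaw {G : Type*} [AddGroup G] [Fintype G] (p : G → ℝ) : G → ℝ :=
  conv (uniform G) p

/-- The distribution `d` with mass `1 - D` at zero and mass `D` spread evenly over the other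
elements of the group. -/
noncomputable def distortionLaw (G : Type*) [AddGroup G] [Fintype G] [DecidableEq G] (D : ℝ) :
    G → ℝ :=
  fun g => if g = 0 then 1 - D else D / ((Fintype.card G : ℝ) - 1)

/-- The law of `(X, X̂)` under the symmetric test channel: `X` has the law of the source and the
difference between `X̂` and `X` is independent of `X` with law `d`. (The value of `d` at `-x + x̂`
depends only on whether `x = x̂`, so the order of the sum is immaterial.) -/
noncomputable def testLaw {G : Type*} [AddGroup G] [Fintype G] [DecidableEq G]
    (p : G → ℝ) (D : ℝ) : G × G → ℝ :=
  fun a => sourceLaw p a.1 * distortionLaw G D (-a.1 + a.2)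

/-- Number of positions `k` at which the pair of words `(x, w)` shows the pair of letters `a`. -/
def pairCount {α : Type*} [DecidableEq α] {n : ℕ} (x w : Fin n → α) (a : α × α) : ℕ :=
  (Finset.univ.filter fun k => (x k, w k) = a).card

/-- Strong joint typicality of the words `x` and `w` with respect to the joint law `J`, with
tolerance `ε`: the joint empirical frequencies are within `ε / |α|²` of `J`, and pairs of letters
of probability zero do not occur. -/
def JointlyTypical {α : Type*} [Fintype α] [DecidableEq α] (J : α × α → ℝ) (ε : ℝ) {n : ℕ}
    (x w : Fin n → α) : Prop :=
  ∀ a, (0 < J a → |(pairCount x w a : ℝ) / n - J a| < ε / (Fintype.card α : ℝ) ^ 2) ∧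
    (J a = 0 → pairCount x w a = 0)

/-- A code of length `n` over `α` with `M` codewords, listed with possible repetitions. -/
abbrev Code (α : Type*) (n M : ℕ) : Type _ := Fin M → Fin n → α

/-- Probability of the word `x` when its letters are drawn i.i.d. from `p`. -/
noncomputable def wordProb {α : Type*} (p : α → ℝ) {n : ℕ} (x : Fin n → α) : ℝ :=
  ∏ k, p (x k)

/-- Probability of the code `c` when all letters of all codewords are drawn i.i.d. from `p`. -/
noncomputable def codeProb {α : Type*} (p : α → ℝ) {n M : ℕ} (c : Code α n M) : ℝ :=
  ∏ i, wordProb p (c i)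

/-- `M n` is the number of codewords at block length `n` of a family of nonempty codes of rate `R`
bits per symbol. -/
def HasRate (M : ℕ → ℕ) (R : ℝ) : Prop :=
  (∀ n, 0 < M n) ∧ Tendsto (fun n => Real.logb 2 (M n : ℝ) / (n : ℝ)) atTop (𝓝 R)

/-- A (possibly randomized) encoding rule: given the two codes and the source word, it returns a
vector of probabilities of selecting each pair of codewords. -/
abbrev Encoder (α : Type*) (n M₀ M₁ : ℕ) : Type _ :=
  Code α n M₀ → Code α n M₁ → (Fin n → α) → Fin M₀ × Fin M₁ → ℝ

/-- The encoding rule selects a pair `(c₀, c₁)` whose sum is jointly typical with the source word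
whenever there is one, and otherwise a uniformly random pair. -/
structure IsTypicalEncoder {G : Type*} [AddGroup G] [Fintype G] [DecidableEq G]
    (J : G × G → ℝ) (ε : ℝ) {n M₀ M₁ : ℕ} (enc : Encoder G n M₀ M₁) : Prop where
  isLaw : ∀ c₀ c₁ x, enc c₀ c₁ x ∈ stdSimplex ℝ (Fin M₀ × Fin M₁)
  typical : ∀ c₀ c₁ x, (∃ s : Fin M₀ × Fin M₁, JointlyTypical J ε x (c₀ s.1 + c₁ s.2)) →
    ∀ s, enc c₀ c₁ x s ≠ 0 → JointlyTypical J ε x (c₀ s.1 + c₁ s.2)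
  fallback : ∀ c₀ c₁ x, (¬ ∃ s : Fin M₀ × Fin M₁, JointlyTypical J ε x (c₀ s.1 + c₁ s.2)) →
    enc c₀ c₁ x = uniform (Fin M₀ × Fin M₁)

/-- Probability, over the source `x = y + z`, the two random codes and the encoding rule, that the
normalized Hamming distance between `x` and the selected `c₀ + c₁` exceeds `t`. -/
noncomputable def encoderErrorProb {G : Type*} [AddGroup G] [Fintype G] [DecidableEq G]
    (p q : G → ℝ) {n M₀ M₁ : ℕ} (enc : Encoder G n M₀ M₁) (t : ℝ) : ℝ :=
  ∑ y : Fin n → G, ∑ z : Fin n → G, ∑ c₀ : Code G n M₀, ∑ c₁ : Code G n M₁,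
    wordProb (uniform G) y * wordProb p z * codeProb (uniform G) c₀ * codeProb q c₁ *
      ∑ s : Fin M₀ × Fin M₁,
        if t < (hammingDist (y + z) (c₀ s.1 + c₁ s.2) : ℝ) / n then enc c₀ c₁ (y + z) s else 0

/-- Mutual information, in bits, of the two coordinates of a pair with joint law `J`. -/
noncomputable def mutualInfo {α : Type*} [Fintype α] (J : α × α → ℝ) : ℝ :=
  entropy (fun a => ∑ b, J (a, b)) + entropy (fun b => ∑ a, J (a, b)) - entropy J

/-- The values of `I(X; X̂)` over all joint laws of `(X, X̂)` for which `X` has law `P` and the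
expected Hamming distortion `Pr(X ≠ X̂)` is at most `D`; the rate-distortion function of `P` at `D`
is the least element of this set. -/
def achievableInfo {α : Type*} [Fintype α] [DecidableEq α] (P : α → ℝ) (D : ℝ) : Set ℝ :=
  {I | ∃ J ∈ stdSimplex ℝ (α × α), (∀ a, ∑ b, J (a, b) = P a) ∧
    (∑ a : α × α, if a.1 ≠ a.2 then J a else 0) ≤ D ∧ I = mutualInfo J}

end SuperpositionCoding

open SuperpositionCoding
/-!
A word `w` obtained from the uniform source word `x` by adding noise of law `d` splits as
`w = c₀ + c₁` with `c₁` of law `q`. The density of the pair `(c₀, c₁)` with respect to independent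
codewords, truncated to the splittings for which `d` at `-x + w` and the law of the noise minus `c₁`
at `-x + c₀` take about their typical values, is averaged over all pairs of codewords. This average
has mean close to `1`. In its second moment, two pairs sharing both codewords cost
`|G|ⁿ 2^(-n H(d)) / (M₀ M₁)`, pairs sharing only the first one cost `|G|ⁿ 2^(-n H(q ∗ d)) / M₀`, and
pairs sharing only the second one cost nothing, because `c₀` is uniform. Under the two rate
conditions both costs vanish, and by the Cauchy–Schwarz inequality some pair of codewords hits the
target set with probability tending to `1`.

The rate conditions are open in `D`, so the covering argument may be run at a slightly lower noise
level; this yields the constraint `D` without slack. For the rate-distortion function, the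
additive noise channel attains `H(X) - H(d)`, and Gibbs' inequality against the backward channel
with noise law `d` gives the converse in the form of Fano's inequality.
-/

namespace SuperpositionCoding

section Mean

theorem indicator_one_nonneg {Ω : Type*} (S : Set Ω) (ω : Ω) : 0 ≤ S.indicator (1 : Ω → ℝ) ω :=
  Set.indicator_nonneg (fun _ _ => zero_le_one) _

variable {Ω Ω' : Type*} [Fintype Ω] [Fintype Ω'] {w : Ω → ℝ}

/-- The mean of `f` with respect to the weights `w`. The outcome spaces are all finite, so that
probabilities and expectations are finite sums; `w` is not required to be a probability vector. -/
noncomputable def mean (w f : Ω → ℝ) : ℝ :=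
  ∑ ω, w ω * f ω

/-- The total weight of the outcomes in `S`. -/
noncomputable def prob (w : Ω → ℝ) (S : Set Ω) : ℝ :=
  mean w (S.indicator 1)

/-- The law of a pair of independent outcomes with laws `w` and `v`. -/
def prodLaw (w : Ω → ℝ) (v : Ω' → ℝ) : Ω × Ω' → ℝ :=
  fun a => w a.1 * v a.2

theorem mean_mono {f g : Ω → ℝ} (hw : ∀ ω, 0 ≤ w ω) (h : ∀ ω, w ω ≠ 0 → f ω ≤ g ω) :
    mean w f ≤ mean w g := by
  refine Finset.sum_le_sum fun ω _ => ?_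
  obtain h0 | h0 := eq_or_ne (w ω) 0
  · rw [h0, zero_mul, zero_mul]
  · exact mul_le_mul_of_nonneg_left (h ω h0) (hw ω)

theorem mean_nonneg {f : Ω → ℝ} (hw : ∀ ω, 0 ≤ w ω) (hf : ∀ ω, 0 ≤ f ω) : 0 ≤ mean w f :=
  Finset.sum_nonneg fun ω _ => mul_nonneg (hw ω) (hf ω)

theorem mean_add (w f g : Ω → ℝ) : mean w (fun ω => f ω + g ω) = mean w f + mean w g := by
  simp only [mean, mul_add, Finset.sum_add_distrib]

theorem mean_const_mul (w f : Ω → ℝ) (c : ℝ) : mean w (fun ω => c * f ω) = c * mean w f := by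
  simp only [mean, Finset.mul_sum, mul_left_comm]

theorem mean_const (hw : ∑ ω, w ω = 1) (c : ℝ) : mean w (fun _ => c) = c := by
  rw [mean, ← Finset.sum_mul, hw, one_mul]

theorem mean_comm (w : Ω → ℝ) (v : Ω' → ℝ) (f : Ω → Ω' → ℝ) :
    mean w (fun ω => mean v (f ω)) = mean v fun ω' => mean w fun ω => f ω ω' := by
  simp only [mean, Finset.mul_sum]
  rw [Finset.sum_comm]
  simp only [mul_left_comm]

theorem mean_prodLaw (w : Ω → ℝ) (v : Ω' → ℝ) (f : Ω × Ω' → ℝ) :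
    mean (prodLaw w v) f = mean w fun ω => mean v fun ω' => f (ω, ω') := by
  simp only [mean, prodLaw, Fintype.sum_prod_type, Finset.mul_sum, mul_assoc]

theorem prodLaw_mem_stdSimplex {v : Ω' → ℝ} (hw : w ∈ stdSimplex ℝ Ω) (hv : v ∈ stdSimplex ℝ Ω') :
    prodLaw w v ∈ stdSimplex ℝ (Ω × Ω') := by
  refine ⟨fun a => mul_nonneg (hw.1 _) (hv.1 _), ?_⟩
  simp only [prodLaw, Fintype.sum_prod_type, ← Finset.mul_sum, hv.2, hw.2, mul_one]

theorem uniform_mem_stdSimplex (α : Type*) [Fintype α] [Nonempty α] :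
    uniform α ∈ stdSimplex ℝ α :=
  ⟨fun _ => one_div_nonneg.2 (Nat.cast_nonneg _), by simp [uniform]⟩

theorem prob_nonneg (hw : ∀ ω, 0 ≤ w ω) (S : Set Ω) : 0 ≤ prob w S :=
  mean_nonneg hw (indicator_one_nonneg S)

theorem prob_mono {S T : Set Ω} (hw : ∀ ω, 0 ≤ w ω) (h : ∀ ω, w ω ≠ 0 → ω ∈ S → ω ∈ T) :
    prob w S ≤ prob w T := by
  refine mean_mono hw fun ω h0 => ?_
  by_cases hS : ω ∈ S
  · rw [Set.indicator_of_mem hS, Set.indicator_of_mem (h ω h0 hS)]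
  · rw [Set.indicator_of_notMem hS]
    exact indicator_one_nonneg T ω

theorem prob_empty (w : Ω → ℝ) : prob w ∅ = 0 := by
  simp [prob, mean]

theorem prob_le_one (hw : w ∈ stdSimplex ℝ Ω) (S : Set Ω) : prob w S ≤ 1 :=
  (prob_mono hw.1 fun _ _ _ => Set.mem_univ _).trans_eq (by simp [prob, mean, hw.2])

theorem prob_iUnion_le {ι : Type*} [Fintype ι] (hw : ∀ ω, 0 ≤ w ω) (S : ι → Set Ω) :
    prob w (⋃ i, S i) ≤ ∑ i, prob w (S i) := by
  simp only [prob, mean]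
  rw [Finset.sum_comm]
  refine Finset.sum_le_sum fun ω _ => ?_
  rw [← Finset.mul_sum]
  refine mul_le_mul_of_nonneg_left ?_ (hw ω)
  by_cases hω : ω ∈ ⋃ i, S i
  · obtain ⟨i, hi⟩ := Set.mem_iUnion.1 hω
    rw [Set.indicator_of_mem hω, ← Set.indicator_of_mem hi (1 : Ω → ℝ)]
    exact Finset.single_le_sum (fun j _ => indicator_one_nonneg (S j) ω) (Finset.mem_univ i)
  · rw [Set.indicator_of_notMem hω]
    exact Finset.sum_nonneg fun i _ => indicator_one_nonneg (S i) ω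

theorem prob_union_le (hw : ∀ ω, 0 ≤ w ω) (S T : Set Ω) : prob w (S ∪ T) ≤ prob w S + prob w T := by
  simpa [Set.union_eq_iUnion] using prob_iUnion_le hw fun b : Bool => cond b S T

theorem prob_compl (hw : ∑ ω, w ω = 1) (S : Set Ω) : prob w Sᶜ = 1 - prob w S := by
  rw [eq_sub_iff_add_eq, prob, prob, ← mean_add]
  exact (congrArg (mean w) (Set.indicator_compl_add_self S 1)).trans (mean_const hw 1)

theorem sq_mean_le_prob_mul_mean_sq (hw : ∀ ω, 0 ≤ w ω) (f : Ω → ℝ) :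
    mean w f ^ 2 ≤ prob w {ω | f ω ≠ 0} * mean w fun ω => f ω ^ 2 := by
  refine Finset.sum_sq_le_sum_mul_sum_of_sq_le_mul _
    (fun ω _ => mul_nonneg (hw ω) (indicator_one_nonneg _ ω))
    (fun ω _ => mul_nonneg (hw ω) (sq_nonneg _)) fun ω _ => ?_
  by_cases h : f ω = 0
  · simp [h]
  · rw [Set.indicator_of_mem h, Pi.one_apply]
    exact le_of_eq (by ring)

theorem prob_le_abs_mul_sq_le_mean_sq (hw : ∀ ω, 0 ≤ w ω) (f : Ω → ℝ) {δ : ℝ} (hδ : 0 ≤ δ) :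
    prob w {ω | δ ≤ |f ω|} * δ ^ 2 ≤ mean w fun ω => f ω ^ 2 := by
  rw [prob, mul_comm, ← mean_const_mul]
  refine mean_mono hw fun ω _ => ?_
  by_cases h : ω ∈ {ω | δ ≤ |f ω|}
  · rw [Set.indicator_of_mem h, Pi.one_apply, mul_one, ← sq_abs (f ω)]
    exact pow_le_pow_left₀ hδ h 2
  · rw [Set.indicator_of_notMem h, mul_zero]
    exact sq_nonneg _

end Mean

section Word

variable {α : Type*} {n : ℕ}

/-- The average of `φ` over the letters of the word `x`; it is `0` for the empty word. -/
noncomputable def empiricalMean (φ : α → ℝ) (x : Fin n → α) : ℝ :=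
  mean (uniform (Fin n)) fun k => φ (x k)

theorem mean_uniform {ι : Type*} [Fintype ι] (f : ι → ℝ) :
    mean (uniform ι) f = (∑ i, f i) / Fintype.card ι := by
  simp only [mean, uniform, one_div_mul_eq_div, Finset.sum_div]

theorem empiricalMean_eq_div (φ : α → ℝ) (x : Fin n → α) :
    empiricalMean φ x = (∑ k, φ (x k)) / n := by
  rw [empiricalMean, mean_uniform, Fintype.card_fin]

theorem empiricalMean_sub_const (hn : n ≠ 0) (φ : α → ℝ) (c : ℝ) (x : Fin n → α) :
    empiricalMean (fun a => φ a - c) x = empiricalMean φ x - c := by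
  simp only [empiricalMean_eq_div, Finset.sum_sub_distrib, Finset.sum_const, Finset.card_univ,
    Fintype.card_fin, nsmul_eq_mul]
  field_simp

variable [Fintype α] {P : α → ℝ}

theorem mean_wordProb_prod (P : α → ℝ) (f : Fin n → α → ℝ) :
    mean (wordProb P) (fun x => ∏ k, f k (x k)) = ∏ k, mean P (f k) := by
  classical
  simp only [mean, wordProb, ← Finset.prod_mul_distrib, Finset.prod_univ_sum,
    Fintype.piFinset_univ]

theorem sum_wordProb (hP : ∑ a, P a = 1) : ∑ x : Fin n → α, wordProb P x = 1 := by
  simpa [mean, hP] using mean_wordProb_prod (n := n) P fun _ _ => 1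

theorem wordProb_mem_stdSimplex (hP : P ∈ stdSimplex ℝ α) :
    wordProb P ∈ stdSimplex ℝ (Fin n → α) :=
  ⟨fun _ => Finset.prod_nonneg fun _ _ => hP.1 _, sum_wordProb hP.2⟩

theorem mean_wordProb_apply (hP : ∑ a, P a = 1) (i : Fin n) (f : α → ℝ) :
    mean (wordProb P) (fun x => f (x i)) = mean P f := by
  have h := mean_wordProb_prod P fun k a => if k = i then f a else 1
  rw [Finset.prod_eq_single i (fun k _ hk => by simp [hk, mean_const hP]) (by simp)] at h
  simpa [Finset.prod_ite_eq'] using h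

theorem mean_wordProb_apply_mul_apply (hP : ∑ a, P a = 1) {i j : Fin n} (hij : i ≠ j)
    (f g : α → ℝ) :
    mean (wordProb P) (fun x => f (x i) * g (x j)) = mean P f * mean P g := by
  have h := mean_wordProb_prod P fun k a =>
    (if k = i then f a else 1) * (if k = j then g a else 1)
  rw [Finset.prod_eq_mul i j hij (fun k _ hk => by simp [hk, mean_const hP]) (by simp)
    (by simp)] at h
  simpa only [Finset.prod_mul_distrib, Finset.prod_ite_eq', Finset.mem_univ, if_true, hij,
    hij.symm, if_false, mul_one, one_mul] using h

theorem mean_wordProb_empiricalMean (hP : ∑ a, P a = 1) (hn : n ≠ 0) (φ : α → ℝ) :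
    mean (wordProb P) (empiricalMean (n := n) φ) = mean P φ := by
  have : NeZero n := ⟨hn⟩
  calc mean (wordProb P) (empiricalMean (n := n) φ)
      = mean (uniform (Fin n)) fun k => mean (wordProb P) fun x => φ (x k) := mean_comm _ _ _
    _ = mean P φ := by
      simp only [mean_wordProb_apply hP, mean_const (uniform_mem_stdSimplex (Fin n)).2]

theorem mean_wordProb_empiricalMean_sq_le (hP : ∑ a, P a = 1) (φ : α → ℝ) :
    mean (wordProb P) (fun x : Fin n → α => empiricalMean φ x ^ 2) ≤
      (mean P fun a => φ a ^ 2) / n + mean P φ ^ 2 := by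
  set m := mean P φ
  set v := mean P fun a => φ a ^ 2
  have hpair (i j : Fin n) :
      mean (wordProb P) (fun x => φ (x i) * φ (x j)) = if i = j then v else m ^ 2 := by
    split_ifs with hij
    · subst hij
      simpa only [v, sq] using mean_wordProb_apply hP i fun a => φ a * φ a
    · rw [mean_wordProb_apply_mul_apply hP hij, sq]
  have hsq : mean (wordProb P) (fun x : Fin n → α => empiricalMean φ x ^ 2) =
      (∑ i : Fin n, ∑ j : Fin n, if i = j then v else m ^ 2) / n ^ 2 := by
    simp only [empiricalMean_eq_div, div_pow, sq (Finset.sum _ _), Finset.sum_mul_sum, ← hpair]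
    simp only [mean, mul_div_assoc', ← Finset.sum_div, Finset.mul_sum]
    rw [Finset.sum_comm]
    simp only [Finset.sum_comm (s := (Finset.univ : Finset (Fin n → α)))]
  have hle (i j : Fin n) : (if i = j then v else m ^ 2) ≤ (if i = j then v else 0) + m ^ 2 := by
    split_ifs <;> linarith [sq_nonneg m]
  calc mean (wordProb P) (fun x : Fin n → α => empiricalMean φ x ^ 2)
      ≤ (∑ i : Fin n, ∑ j : Fin n, ((if i = j then v else 0) + m ^ 2)) / n ^ 2 := by
        rw [hsq]
        gcongr
        exact hle _ _
    _ = (n * v + n ^ 2 * m ^ 2) / n ^ 2 := by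
        simp [Finset.sum_add_distrib, sq, mul_assoc]
    _ ≤ v / n + m ^ 2 := by
        rcases n.eq_zero_or_pos with rfl | hn
        · simp [sq_nonneg]
        · exact le_of_eq (by field_simp)

theorem tendsto_prob_empiricalMean_notMem (hP : P ∈ stdSimplex ℝ α) {φ : α → ℝ} {s : Set ℝ}
    (hs : s ∈ 𝓝 (mean P φ)) :
    Tendsto (fun n => prob (wordProb P) {x : Fin n → α | empiricalMean φ x ∉ s}) atTop (𝓝 0) := by
  obtain ⟨δ, hδ, hball⟩ := Metric.mem_nhds_iff.1 hs
  set m := mean P φ with hm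
  have hcentered : mean P (fun a => φ a - m) = 0 := by
    simpa only [sub_eq_add_neg, mean_const hP.2, ← hm, add_neg_cancel] using
      mean_add P φ fun _ => -m
  set v := mean P fun a => (φ a - m) ^ 2
  refine squeeze_zero' (.of_forall fun n => prob_nonneg (wordProb_mem_stdSimplex hP).1 _) ?_
    (tendsto_const_div_atTop_nhds_zero_nat (v / δ ^ 2))
  filter_upwards [eventually_ne_atTop 0] with n hn
  calc prob (wordProb P) {x : Fin n → α | empiricalMean φ x ∉ s}
      ≤ prob (wordProb P) {x : Fin n → α | δ ≤ |empiricalMean (fun a => φ a - m) x|} := by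
        refine prob_mono (wordProb_mem_stdSimplex hP).1 fun x _ hx => ?_
        rw [Set.mem_ofPred_eq, empiricalMean_sub_const hn, ← Real.dist_eq]
        exact not_lt.1 fun h => hx (hball h)
    _ ≤ v / n / δ ^ 2 := by
        rw [le_div_iff₀ (pow_pos hδ 2)]
        simpa only [hcentered, zero_pow two_ne_zero, add_zero] using
          (prob_le_abs_mul_sq_le_mean_sq (wordProb_mem_stdSimplex hP).1 _ hδ.le).trans
            (mean_wordProb_empiricalMean_sq_le (n := n) hP.2 fun a => φ a - m)
    _ = v / δ ^ 2 / n := by rw [div_right_comm]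

theorem entropy_eq_mean (P : α → ℝ) : entropy P = mean P fun a => -Real.logb 2 (P a) := by
  simp only [entropy, mean, Real.negMulLog, Real.logb, mul_neg, neg_mul, mul_div_assoc', neg_div]

theorem tendsto_prob_rpow_lt_wordProb (hP : P ∈ stdSimplex ℝ α) {h : ℝ} (hh : h < entropy P) :
    Tendsto (fun n : ℕ => prob (wordProb P)
      {x : Fin n → α | (2 : ℝ) ^ (-(n * h)) < wordProb P x}) atTop (𝓝 0) := by
  rw [entropy_eq_mean] at hh
  refine squeeze_zero' (.of_forall fun n => prob_nonneg (wordProb_mem_stdSimplex hP).1 _) ?_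
    (tendsto_prob_empiricalMean_notMem hP (Ioi_mem_nhds hh))
  filter_upwards [eventually_gt_atTop 0] with n hn
  refine prob_mono (wordProb_mem_stdSimplex hP).1 fun x hx0 hx => ?_
  have hn' : (0 : ℝ) < n := Nat.cast_pos.2 hn
  have hlog : -(n * h) < ∑ k, Real.logb 2 (P (x k)) := by
    rw [← Real.logb_prod _ _ fun k hk => Finset.prod_ne_zero_iff.1 hx0 k hk,
      Real.lt_logb_iff_rpow_lt one_lt_two]
    · exact hx
    · exact (Real.rpow_pos_of_pos two_pos _).trans hx
  rw [Set.mem_ofPred_eq, Set.mem_Ioi, not_lt, empiricalMean_eq_div, div_le_iff₀ hn',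
    Finset.sum_neg_distrib]
  linarith

end Word

section Rate

theorem HasRate.tendsto_rpow_div {M : ℕ → ℕ} {R c : ℝ} (hM : HasRate M R) (hc : c < R) :
    Tendsto (fun n : ℕ => (2 : ℝ) ^ (n * c) / M n) atTop (𝓝 0) := by
  obtain ⟨c', hcc', hc'R⟩ := exists_between hc
  have hgeo : Tendsto (fun n : ℕ => ((2 : ℝ) ^ (c - c')) ^ n) atTop (𝓝 0) :=
    tendsto_pow_atTop_nhds_zero_of_lt_one (by positivity)
      (Real.rpow_lt_one_of_one_lt_of_neg one_lt_two (by linarith))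
  refine squeeze_zero' (.of_forall fun n => by positivity) ?_ hgeo
  filter_upwards [eventually_gt_atTop 0, hM.2.eventually (lt_mem_nhds hc'R)] with n hn hlt
  have hMpos : (0 : ℝ) < M n := Nat.cast_pos.2 (hM.1 n)
  rw [lt_div_iff₀ (Nat.cast_pos.2 hn), Real.lt_logb_iff_rpow_lt one_lt_two hMpos] at hlt
  rw [div_le_iff₀ hMpos, ← Real.rpow_natCast, ← Real.rpow_mul two_pos.le]
  calc (2 : ℝ) ^ (n * c) = 2 ^ ((c - c') * n) * 2 ^ (c' * n) := by
        rw [← Real.rpow_add two_pos]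
        ring_nf
    _ ≤ 2 ^ ((c - c') * n) * M n := by gcongr

theorem HasRate.mul {M M' : ℕ → ℕ} {R R' : ℝ} (hM : HasRate M R) (hM' : HasRate M' R') :
    HasRate (fun n => M n * M' n) (R + R') := by
  refine ⟨fun n => Nat.mul_pos (hM.1 n) (hM'.1 n), (hM.2.add hM'.2).congr fun n => ?_⟩
  rw [Nat.cast_mul, Real.logb_mul (Nat.cast_ne_zero.2 (hM.1 n).ne')
    (Nat.cast_ne_zero.2 (hM'.1 n).ne'), add_div]

end Rate

section TwoCodes

variable {U V : Type*} {M₀ M₁ : ℕ}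

/-- The average of `f` over all pairs consisting of a codeword of `c.1` and a codeword of `c.2`. -/
noncomputable def pairMean (f : U → V → ℝ) (c : (Fin M₀ → U) × (Fin M₁ → V)) : ℝ :=
  empiricalMean (fun u => empiricalMean (f u) c.2) c.1

theorem exists_ne_zero_of_pairMean_ne_zero {f : U → V → ℝ} {c : (Fin M₀ → U) × (Fin M₁ → V)}
    (h : pairMean f c ≠ 0) : ∃ s : Fin M₀ × Fin M₁, f (c.1 s.1) (c.2 s.2) ≠ 0 := by
  contrapose! h
  have h' (i : Fin M₀) (j : Fin M₁) : f (c.1 i) (c.2 j) = 0 := h (i, j)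
  simp [pairMean, empiricalMean, mean, h']

variable [Fintype U] [Fintype V] {P : U → ℝ} {Q : V → ℝ} {f : U → V → ℝ} {B₁ B₂ : ℝ}

theorem mean_sq_le {φ : U → ℝ} {B : ℝ} (hP : ∀ u, 0 ≤ P u) (hφ : ∀ u, 0 ≤ φ u)
    (hB : ∀ u, φ u ≤ B) : mean P (fun u => φ u ^ 2) ≤ B * mean P φ := by
  rw [← mean_const_mul]
  refine mean_mono hP fun u _ => ?_
  rw [sq]
  exact mul_le_mul_of_nonneg_right (hB u) (hφ u)

theorem mean_pairMean (hP : ∑ u, P u = 1) (hQ : ∑ v, Q v = 1) (hM₀ : M₀ ≠ 0) (hM₁ : M₁ ≠ 0)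
    (f : U → V → ℝ) :
    mean (prodLaw (wordProb P) (wordProb Q)) (pairMean (M₀ := M₀) (M₁ := M₁) f) =
      mean P fun u => mean Q (f u) := by
  rw [mean_prodLaw, mean_comm]
  simp only [pairMean, mean_wordProb_empiricalMean hP hM₀]
  rw [mean_comm]
  simp only [mean_wordProb_empiricalMean hQ hM₁]

theorem mean_empiricalMean_sq_le_mul (hP : ∀ u, 0 ≤ P u) (hQ : Q ∈ stdSimplex ℝ V)
    (hf : ∀ u v, 0 ≤ f u v) (hB₁ : ∀ u v, f u v ≤ B₁) (hB₂ : ∀ u, mean Q (f u) ≤ B₂) :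
    mean (wordProb Q) (fun c₁ : Fin M₁ → V => mean P fun u => empiricalMean (f u) c₁ ^ 2) ≤
      (B₁ / M₁ + B₂) * mean P fun u => mean Q (f u) := by
  rw [mean_comm, ← mean_const_mul]
  refine mean_mono hP fun u _ => ?_
  calc mean (wordProb Q) (fun c₁ : Fin M₁ → V => empiricalMean (f u) c₁ ^ 2)
      ≤ (mean Q fun v => f u v ^ 2) / M₁ + mean Q (f u) ^ 2 :=
        mean_wordProb_empiricalMean_sq_le hQ.2 (f u)
    _ ≤ B₁ * mean Q (f u) / M₁ + B₂ * mean Q (f u) := by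
        have := mean_nonneg hQ.1 (hf u)
        rw [sq (mean Q (f u))]
        gcongr
        exacts [mean_sq_le hQ.1 (hf u) (hB₁ u), hB₂ u]
    _ = (B₁ / M₁ + B₂) * mean Q (f u) := by ring

theorem mean_sq_mean_empiricalMean_le (hP : ∀ u, 0 ≤ P u) (hQ : Q ∈ stdSimplex ℝ V) (hM₁ : M₁ ≠ 0)
    (hf : ∀ u v, 0 ≤ f u v) (hf₁ : ∀ v, mean P (fun u => f u v) ≤ 1) :
    mean (wordProb Q) (fun c₁ : Fin M₁ → V => mean P (fun u => empiricalMean (f u) c₁) ^ 2) ≤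
      mean P fun u => mean Q (f u) := by
  have : NeZero M₁ := ⟨hM₁⟩
  have hunif := uniform_mem_stdSimplex (Fin M₁)
  set g : V → ℝ := fun v => mean P fun u => f u v
  have hg (c₁ : Fin M₁ → V) : mean P (fun u => empiricalMean (f u) c₁) = empiricalMean g c₁ :=
    mean_comm _ _ _
  have hg0 (c₁ : Fin M₁ → V) : 0 ≤ empiricalMean g c₁ :=
    mean_nonneg hunif.1 fun _ => mean_nonneg hP fun _ => hf _ _
  have hg1 (c₁ : Fin M₁ → V) : empiricalMean g c₁ ≤ 1 :=
    (mean_mono hunif.1 fun _ _ => hf₁ _).trans_eq (mean_const hunif.2 1)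
  calc mean (wordProb Q) (fun c₁ : Fin M₁ → V => mean P (fun u => empiricalMean (f u) c₁) ^ 2)
      ≤ 1 * mean (wordProb Q) (empiricalMean (n := M₁) g) := by
        simp only [hg]
        exact mean_sq_le (wordProb_mem_stdSimplex hQ).1 hg0 hg1
    _ = mean P fun u => mean Q (f u) := by
        rw [one_mul, mean_wordProb_empiricalMean hQ.2 hM₁]
        exact mean_comm _ _ _

theorem mean_pairMean_sq_le (hP : P ∈ stdSimplex ℝ U) (hQ : Q ∈ stdSimplex ℝ V) (hM₁ : M₁ ≠ 0)
    (hf : ∀ u v, 0 ≤ f u v) (hB₁ : ∀ u v, f u v ≤ B₁) (hB₂ : ∀ u, mean Q (f u) ≤ B₂)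
    (hf₁ : ∀ v, mean P (fun u => f u v) ≤ 1) :
    mean (prodLaw (wordProb P) (wordProb Q))
        (fun c : (Fin M₀ → U) × (Fin M₁ → V) => pairMean f c ^ 2) ≤
      mean P (fun u => mean Q (f u)) * (1 + B₁ / (M₀ * M₁) + B₂ / M₀) := by
  have hc₁ (c₁ : Fin M₁ → V) :
      mean (wordProb P) (fun c₀ : Fin M₀ → U => pairMean f (c₀, c₁) ^ 2) ≤
        (M₀ : ℝ)⁻¹ * mean P (fun u => empiricalMean (f u) c₁ ^ 2) +
          mean P (fun u => empiricalMean (f u) c₁) ^ 2 := by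
    rw [inv_mul_eq_div]
    exact mean_wordProb_empiricalMean_sq_le hP.2 fun u => empiricalMean (f u) c₁
  rw [mean_prodLaw, mean_comm]
  calc mean (wordProb Q) (fun c₁ : Fin M₁ → V => mean (wordProb P) fun c₀ : Fin M₀ → U =>
        pairMean f (c₀, c₁) ^ 2)
      ≤ mean (wordProb Q) fun c₁ : Fin M₁ → V =>
          (M₀ : ℝ)⁻¹ * mean P (fun u => empiricalMean (f u) c₁ ^ 2) +
            mean P (fun u => empiricalMean (f u) c₁) ^ 2 :=
        mean_mono (wordProb_mem_stdSimplex hQ).1 fun c₁ _ => hc₁ c₁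
    _ ≤ (M₀ : ℝ)⁻¹ * ((B₁ / M₁ + B₂) * mean P fun u => mean Q (f u)) +
          mean P fun u => mean Q (f u) := by
        rw [mean_add, mean_const_mul]
        gcongr
        exacts [mean_empiricalMean_sq_le_mul hP.1 hQ hf hB₁ hB₂,
          mean_sq_mean_empiricalMean_le hP.1 hQ hM₁ hf hf₁]
    _ = mean P (fun u => mean Q (f u)) * (1 + B₁ / (M₀ * M₁) + B₂ / M₀) := by ring

theorem mean_le_prob_exists_mul (hP : P ∈ stdSimplex ℝ U) (hQ : Q ∈ stdSimplex ℝ V)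
    (hM₀ : M₀ ≠ 0) (hM₁ : M₁ ≠ 0) (hf : ∀ u v, 0 ≤ f u v) (hB₁ : ∀ u v, f u v ≤ B₁)
    (hB₂ : ∀ u, mean Q (f u) ≤ B₂) (hf₁ : ∀ v, mean P (fun u => f u v) ≤ 1)
    (hB : 0 ≤ 1 + B₁ / (M₀ * M₁) + B₂ / M₀) :
    mean P (fun u => mean Q (f u)) ≤
      prob (prodLaw (wordProb P) (wordProb Q))
          {c : (Fin M₀ → U) × (Fin M₁ → V) | ∃ s : Fin M₀ × Fin M₁, f (c.1 s.1) (c.2 s.2) ≠ 0} *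
        (1 + B₁ / (M₀ * M₁) + B₂ / M₀) := by
  have hw := prodLaw_mem_stdSimplex (wordProb_mem_stdSimplex (n := M₀) hP)
    (wordProb_mem_stdSimplex (n := M₁) hQ)
  set a := mean P fun u => mean Q (f u) with ha
  set S := {c : (Fin M₀ → U) × (Fin M₁ → V) | ∃ s : Fin M₀ × Fin M₁, f (c.1 s.1) (c.2 s.2) ≠ 0}
  set B := 1 + B₁ / (M₀ * M₁) + B₂ / M₀
  obtain h0 | hpos := (mean_nonneg hP.1 fun u => mean_nonneg hQ.1 (hf u)).eq_or_lt
  · rw [ha, ← h0]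
    exact mul_nonneg (prob_nonneg hw.1 _) hB
  · refine le_of_mul_le_mul_right ?_ hpos
    calc a * a
        = mean (prodLaw (wordProb P) (wordProb Q)) (pairMean (M₀ := M₀) (M₁ := M₁) f) ^ 2 := by
          rw [mean_pairMean hP.2 hQ.2 hM₀ hM₁, sq]
      _ ≤ prob (prodLaw (wordProb P) (wordProb Q))
            {c : (Fin M₀ → U) × (Fin M₁ → V) | pairMean f c ≠ 0} * (a * B) :=
          (sq_mean_le_prob_mul_mean_sq hw.1 _).trans <| mul_le_mul_of_nonneg_left
            (mean_pairMean_sq_le hP hQ hM₁ hf hB₁ hB₂ hf₁) (prob_nonneg hw.1 _)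
      _ ≤ prob (prodLaw (wordProb P) (wordProb Q)) S * (a * B) :=
          mul_le_mul_of_nonneg_right
            (prob_mono hw.1 fun _ _ hc => exists_ne_zero_of_pairMean_ne_zero hc)
            (mul_nonneg hpos.le hB)
      _ = prob (prodLaw (wordProb P) (wordProb Q)) S * B * a := by rw [mul_comm a B, mul_assoc]

end TwoCodes

section OneShotCovering

variable {W : Type*} [AddGroup W] [Fintype W] {q r d : W → ℝ}

/-- The law of the difference `B - A` for independent `A ∼ q` and `B ∼ r`. -/
def subLaw (q r : W → ℝ) : W → ℝ :=
  fun u => ∑ v, q v * r (u + v)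

/-- The joint law of `(B - A, A)` for independent `A ∼ q` and `B ∼ r`: it records how a target
`B ∼ r` splits into a summand to be supplied by the first code and one supplied by the second. -/
def splitLaw (q r : W → ℝ) : W × W → ℝ :=
  fun a => q a.2 * r (a.1 + a.2)

/-- The splittings `(u, v)` of a point `u + v` of `S` for which neither the weight of `u + v` under
`r` nor that of `u` under `subLaw q r` is exceptionally large. -/
def goodPairs (q r : W → ℝ) (S : Set W) (β₁ β₂ : ℝ) : Set (W × W) :=
  {a | a.1 + a.2 ∈ S ∧ r (a.1 + a.2) ≤ β₁ ∧ subLaw q r a.1 ≤ β₂}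

theorem mean_splitLaw_add (hq : ∑ v, q v = 1) (r φ : W → ℝ) :
    mean (splitLaw q r) (fun a => φ (a.1 + a.2)) = mean r φ := by
  have hshift (v : W) : ∑ u, r (u + v) * φ (u + v) = mean r φ :=
    Equiv.sum_comp (Equiv.addRight v) fun w => r w * φ w
  simp only [mean, splitLaw, Fintype.sum_prod_type_right, mul_assoc, ← Finset.mul_sum, hshift]
  rw [← Finset.sum_mul, hq, one_mul]

theorem mean_splitLaw_fst (q r φ : W → ℝ) :
    mean (splitLaw q r) (fun a => φ a.1) = mean (subLaw q r) φ := by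
  simp only [mean, splitLaw, subLaw, Fintype.sum_prod_type, Finset.sum_mul]

theorem splitLaw_mem_stdSimplex (hq : q ∈ stdSimplex ℝ W) (hr : r ∈ stdSimplex ℝ W) :
    splitLaw q r ∈ stdSimplex ℝ (W × W) := by
  refine ⟨fun a => mul_nonneg (hq.1 _) (hr.1 _), ?_⟩
  simpa [mean, hr.2] using mean_splitLaw_add hq.2 r fun _ => 1

theorem subLaw_mem_stdSimplex (hq : q ∈ stdSimplex ℝ W) (hr : r ∈ stdSimplex ℝ W) :
    subLaw q r ∈ stdSimplex ℝ W := by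
  refine ⟨fun u => Finset.sum_nonneg fun v _ => mul_nonneg (hq.1 _) (hr.1 _), ?_⟩
  simpa [mean, (splitLaw_mem_stdSimplex hq hr).2] using (mean_splitLaw_fst q r fun _ => 1).symm

theorem one_sub_le_prob_goodPairs (hq : q ∈ stdSimplex ℝ W) (hr : r ∈ stdSimplex ℝ W) (S : Set W)
    (β₁ β₂ : ℝ) :
    1 - prob r Sᶜ - prob r {w | β₁ < r w} - prob (subLaw q r) {u | β₂ < subLaw q r u} ≤
      prob (splitLaw q r) (goodPairs q r S β₁ β₂) := by
  have hsplit := splitLaw_mem_stdSimplex hq hr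
  have hadd (A : Set W) : prob (splitLaw q r) {a | a.1 + a.2 ∈ A} = prob r A :=
    mean_splitLaw_add hq.2 r (A.indicator 1)
  have hfst (A : Set W) : prob (splitLaw q r) {a | a.1 ∈ A} = prob (subLaw q r) A :=
    mean_splitLaw_fst q r (A.indicator 1)
  have hcompl : (goodPairs q r S β₁ β₂)ᶜ ⊆ {a | a.1 + a.2 ∈ Sᶜ} ∪
      {a | a.1 + a.2 ∈ {w | β₁ < r w}} ∪ {a | a.1 ∈ {u | β₂ < subLaw q r u}} := by
    intro a ha
    by_contra h
    simp only [Set.mem_union, Set.mem_ofPred_eq, Set.mem_compl_iff, not_or, not_not, not_lt] at h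
    exact ha ⟨h.1.1, h.1.2, h.2⟩
  have hbad := prob_mono hsplit.1 fun a _ ha => hcompl ha
  rw [prob_compl hsplit.2] at hbad
  have h₁ := prob_union_le hsplit.1 ({a | a.1 + a.2 ∈ Sᶜ} ∪ {a | a.1 + a.2 ∈ {w | β₁ < r w}})
    {a | a.1 ∈ {u | β₂ < subLaw q r u}}
  have h₂ := prob_union_le hsplit.1 {a : W × W | a.1 + a.2 ∈ Sᶜ} {a | a.1 + a.2 ∈ {w | β₁ < r w}}
  rw [hfst] at h₁
  rw [hadd, hadd] at h₂
  linarith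

/-- The density of `splitLaw q r`, restricted to the good pairs, with respect to the law of a pair
of independent codewords, the first of them uniform and the second one drawn from `q`. -/
noncomputable def goodDensity (q r : W → ℝ) (S : Set W) (β₁ β₂ : ℝ) (u v : W) : ℝ :=
  (goodPairs q r S β₁ β₂).indicator (fun a => Fintype.card W * r (a.1 + a.2)) (u, v)

theorem goodDensity_nonneg (hr : ∀ w, 0 ≤ r w) (S : Set W) (β₁ β₂ : ℝ) (u v : W) :
    0 ≤ goodDensity q r S β₁ β₂ u v :=
  Set.indicator_nonneg (fun _ _ => mul_nonneg (Nat.cast_nonneg _) (hr _)) _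

theorem goodDensity_le_card_mul (hr : ∀ w, 0 ≤ r w) (S : Set W) (β₁ β₂ : ℝ) (u v : W) :
    goodDensity q r S β₁ β₂ u v ≤ Fintype.card W * r (u + v) :=
  Set.indicator_le_self' (fun _ _ => mul_nonneg (Nat.cast_nonneg _) (hr _)) _

theorem goodDensity_le (S : Set W) {β₁ : ℝ} (β₂ : ℝ) (hβ₁ : 0 ≤ β₁) (u v : W) :
    goodDensity q r S β₁ β₂ u v ≤ Fintype.card W * β₁ :=
  Set.indicator_le' (fun _ ha => mul_le_mul_of_nonneg_left ha.2.1 (Nat.cast_nonneg _))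
    (fun _ _ => mul_nonneg (Nat.cast_nonneg _) hβ₁) _

theorem mean_uniform_goodDensity_le_one (hr : r ∈ stdSimplex ℝ W) (S : Set W) (β₁ β₂ : ℝ) (v : W) :
    mean (uniform W) (fun u => goodDensity q r S β₁ β₂ u v) ≤ 1 := by
  have hsum : ∑ u, r (u + v) = 1 := (Equiv.sum_comp (Equiv.addRight v) r).trans hr.2
  calc mean (uniform W) (fun u => goodDensity q r S β₁ β₂ u v)
      ≤ mean (uniform W) fun u => Fintype.card W * r (u + v) :=
        mean_mono (uniform_mem_stdSimplex W).1 fun u _ => goodDensity_le_card_mul hr.1 S β₁ β₂ u v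
    _ = 1 := by simp [mean_uniform, ← Finset.mul_sum, hsum]

theorem mean_goodDensity_le (hq : ∀ w, 0 ≤ q w) (hr : ∀ w, 0 ≤ r w) (S : Set W) (β₁ : ℝ) {β₂ : ℝ}
    (hβ₂ : 0 ≤ β₂) (u : W) :
    mean q (goodDensity q r S β₁ β₂ u) ≤ Fintype.card W * β₂ := by
  by_cases hu : subLaw q r u ≤ β₂
  · calc mean q (goodDensity q r S β₁ β₂ u)
        ≤ mean q fun v => Fintype.card W * r (u + v) :=
          mean_mono hq fun v _ => goodDensity_le_card_mul hr S β₁ β₂ u v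
      _ = Fintype.card W * subLaw q r u := mean_const_mul q (fun v => r (u + v)) _
      _ ≤ Fintype.card W * β₂ := by gcongr
  · have h0 (v : W) : goodDensity q r S β₁ β₂ u v = 0 :=
      Set.indicator_of_notMem (fun ha => hu ha.2.2) _
    simp only [mean, h0, mul_zero, Finset.sum_const_zero]
    positivity

theorem mean_mean_goodDensity (q r : W → ℝ) (S : Set W) (β₁ β₂ : ℝ) :
    mean (uniform W) (fun u => mean q (goodDensity q r S β₁ β₂ u)) =
      prob (splitLaw q r) (goodPairs q r S β₁ β₂) := by
  have hterm (u v : W) : q v * goodDensity q r S β₁ β₂ u v =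
      Fintype.card W * (splitLaw q r (u, v) * (goodPairs q r S β₁ β₂).indicator 1 (u, v)) := by
    by_cases ha : (u, v) ∈ goodPairs q r S β₁ β₂
    · simp only [goodDensity, splitLaw, Set.indicator_of_mem ha, Pi.one_apply]
      ring
    · simp [goodDensity, ha]
  rw [mean_uniform]
  simp only [prob, mean, hterm, ← Finset.mul_sum, Fintype.sum_prod_type]
  exact mul_div_cancel_left₀ _ (Nat.cast_ne_zero.2 Fintype.card_ne_zero)

theorem prob_goodPairs_le (hq : q ∈ stdSimplex ℝ W) (hr : r ∈ stdSimplex ℝ W) (S : Set W)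
    {β₁ β₂ : ℝ} (hβ₁ : 0 ≤ β₁) (hβ₂ : 0 ≤ β₂) {M₀ M₁ : ℕ} (hM₀ : M₀ ≠ 0) (hM₁ : M₁ ≠ 0) :
    prob (splitLaw q r) (goodPairs q r S β₁ β₂) ≤
      prob (prodLaw (wordProb (uniform W)) (wordProb q))
          {c : (Fin M₀ → W) × (Fin M₁ → W) | ∃ s : Fin M₀ × Fin M₁, c.1 s.1 + c.2 s.2 ∈ S} *
        (1 + Fintype.card W * β₁ / (M₀ * M₁) + Fintype.card W * β₂ / M₀) := by
  have hunif := uniform_mem_stdSimplex W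
  rw [← mean_mean_goodDensity]
  refine (mean_le_prob_exists_mul hunif hq hM₀ hM₁ (goodDensity_nonneg hr.1 S β₁ β₂)
    (goodDensity_le S β₂ hβ₁) (mean_goodDensity_le hq.1 hr.1 S β₁ hβ₂)
    (mean_uniform_goodDensity_le_one hr S β₁ β₂) (by positivity)).trans ?_
  refine mul_le_mul_of_nonneg_right (prob_mono ?_ ?_) (by positivity)
  · exact (prodLaw_mem_stdSimplex (wordProb_mem_stdSimplex hunif) (wordProb_mem_stdSimplex hq)).1
  · rintro c - ⟨s, hs⟩
    exact ⟨s, (Set.mem_of_indicator_ne_zero hs).1⟩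

/-- The probability that no sum of a codeword of a uniformly drawn code of size `M₀` and a codeword
of a code of size `M₁` drawn from `q` lies in `T x`, for a uniform point `x`. -/
noncomputable def uncoveredProb (q : W → ℝ) (M₀ M₁ : ℕ) (T : W → Set W) : ℝ :=
  mean (uniform W) fun x => prob (prodLaw (wordProb (uniform W)) (wordProb q))
    {c : (Fin M₀ → W) × (Fin M₁ → W) | ¬ ∃ s : Fin M₀ × Fin M₁, c.1 s.1 + c.2 s.2 ∈ T x}

theorem uncoveredProb_nonneg (hq : q ∈ stdSimplex ℝ W) (M₀ M₁ : ℕ) (T : W → Set W) :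
    0 ≤ uncoveredProb q M₀ M₁ T :=
  have hunif := uniform_mem_stdSimplex W
  mean_nonneg hunif.1 fun _ => prob_nonneg (prodLaw_mem_stdSimplex (wordProb_mem_stdSimplex hunif)
    (wordProb_mem_stdSimplex hq)).1 _

theorem sum_neg_add_left (d : W → ℝ) (x : W) : ∑ w, d (-x + w) = ∑ g, d g :=
  Equiv.sum_comp (Equiv.addLeft (-x)) d

theorem sum_neg_add_right (d : W → ℝ) (w : W) : ∑ x, d (-x + w) = ∑ g, d g :=
  Equiv.sum_comp ((Equiv.neg W).trans (Equiv.addRight w)) d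

theorem mean_neg_add (x : W) (d φ : W → ℝ) :
    mean (fun w => d (-x + w)) (fun w => φ (-x + w)) = mean d φ :=
  sum_neg_add_left (fun w => d w * φ w) x

theorem neg_add_mem_stdSimplex (hd : d ∈ stdSimplex ℝ W) (x : W) :
    (fun w => d (-x + w)) ∈ stdSimplex ℝ W :=
  ⟨fun _ => hd.1 _, (sum_neg_add_left d x).trans hd.2⟩

theorem subLaw_neg_add (q d : W → ℝ) (x : W) :
    subLaw q (fun w => d (-x + w)) = fun u => subLaw q d (-x + u) := by
  funext u
  simp only [subLaw, add_assoc]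

theorem one_sub_le_one_sub_prob_not_exists_mul (hq : q ∈ stdSimplex ℝ W) (hd : d ∈ stdSimplex ℝ W)
    (x : W) (S : Set W) {β₁ β₂ : ℝ} (hβ₁ : 0 ≤ β₁) (hβ₂ : 0 ≤ β₂) {M₀ M₁ : ℕ} (hM₀ : M₀ ≠ 0)
    (hM₁ : M₁ ≠ 0) :
    1 - prob (fun w => d (-x + w)) Sᶜ - prob d {w | β₁ < d w} -
        prob (subLaw q d) {u | β₂ < subLaw q d u} ≤
      (1 - prob (prodLaw (wordProb (uniform W)) (wordProb q))
          {c : (Fin M₀ → W) × (Fin M₁ → W) | ¬ ∃ s : Fin M₀ × Fin M₁, c.1 s.1 + c.2 s.2 ∈ S}) *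
        (1 + Fintype.card W * β₁ / (M₀ * M₁) + Fintype.card W * β₂ / M₀) := by
  have hcodes := prodLaw_mem_stdSimplex
    (wordProb_mem_stdSimplex (n := M₀) (uniform_mem_stdSimplex W))
    (wordProb_mem_stdSimplex (n := M₁) hq)
  have hdx := neg_add_mem_stdSimplex hd x
  have hgood := one_sub_le_prob_goodPairs hq hdx S β₁ β₂
  rw [subLaw_neg_add,
    show prob (fun w => d (-x + w)) {w | β₁ < d (-x + w)} = prob d {w | β₁ < d w} from
      mean_neg_add x d ({w | β₁ < d w}.indicator 1),
    show prob (fun u => subLaw q d (-x + u)) {u | β₂ < subLaw q d (-x + u)} =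
        prob (subLaw q d) {u | β₂ < subLaw q d u} from
      mean_neg_add x (subLaw q d) ({u | β₂ < subLaw q d u}.indicator 1)] at hgood
  refine hgood.trans ((prob_goodPairs_le hq hdx S hβ₁ hβ₂ hM₀ hM₁).trans_eq ?_)
  rw [← Set.compl_ofPred, prob_compl hcodes.2, sub_sub_cancel]

theorem one_sub_le_one_sub_uncoveredProb_mul (hq : q ∈ stdSimplex ℝ W) (hd : d ∈ stdSimplex ℝ W)
    (T : W → Set W) {β₁ β₂ : ℝ} (hβ₁ : 0 ≤ β₁) (hβ₂ : 0 ≤ β₂) {M₀ M₁ : ℕ} (hM₀ : M₀ ≠ 0)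
    (hM₁ : M₁ ≠ 0) :
    1 - mean (uniform W) (fun x => prob (fun w => d (-x + w)) (T x)ᶜ) -
        prob d {w | β₁ < d w} - prob (subLaw q d) {u | β₂ < subLaw q d u} ≤
      (1 - uncoveredProb q M₀ M₁ T) *
        (1 + Fintype.card W * β₁ / (M₀ * M₁) + Fintype.card W * β₂ / M₀) := by
  have hunif := uniform_mem_stdSimplex W
  set B := 1 + Fintype.card W * β₁ / (M₀ * M₁) + Fintype.card W * β₂ / M₀
  set p₁ := prob d {w | β₁ < d w}
  set p₂ := prob (subLaw q d) {u | β₂ < subLaw q d u}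
  have hmean : B * uncoveredProb q M₀ M₁ T + (1 - p₁ - p₂ - B) ≤
      mean (uniform W) fun x => prob (fun w => d (-x + w)) (T x)ᶜ := by
    rw [uncoveredProb, ← mean_const_mul, ← mean_const hunif.2 (1 - p₁ - p₂ - B), ← mean_add]
    refine mean_mono hunif.1 fun x _ => ?_
    have := one_sub_le_one_sub_prob_not_exists_mul hq hd x (T x) hβ₁ hβ₂ hM₀ hM₁
    linarith
  linarith

end OneShotCovering

section AsymptoticCovering

variable {G : Type*} [AddGroup G] [Fintype G] {n : ℕ}

/-- The joint law of `(X, X + N)` for `X` uniform and noise `N ∼ d` independent of `X`. -/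
noncomputable def addNoiseLaw (d : G → ℝ) : G × G → ℝ :=
  fun a => uniform G a.1 * d (-a.1 + a.2)

theorem wordProb_uniform (α : Type*) [Fintype α] (n : ℕ) :
    wordProb (n := n) (uniform α) = uniform (Fin n → α) := by
  funext x
  simp [wordProb, uniform]

theorem subLaw_wordProb (q d : G → ℝ) :
    subLaw (wordProb (n := n) q) (wordProb d) = wordProb (subLaw q d) := by
  classical
  funext u
  simp only [subLaw, wordProb, Pi.add_apply, ← Finset.prod_mul_distrib, Finset.prod_univ_sum,
    Fintype.piFinset_univ]

theorem prob_wordProb_addNoiseLaw (d : G → ℝ) (T : (Fin n → G) → Set (Fin n → G)) :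
    prob (wordProb (addNoiseLaw d)) {ω : Fin n → G × G | Prod.snd ∘ ω ∉ T (Prod.fst ∘ ω)} =
      mean (uniform (Fin n → G)) fun x => prob (fun w => wordProb d (-x + w)) (T x)ᶜ := by
  have hfactor (ω : Fin n → G × G) : wordProb (addNoiseLaw d) ω =
      uniform (Fin n → G) (Prod.fst ∘ ω) * wordProb d (-(Prod.fst ∘ ω) + Prod.snd ∘ ω) := by
    rw [← wordProb_uniform]
    exact Finset.prod_mul_distrib
  simp only [prob, mean, hfactor, Finset.mul_sum, ← mul_assoc]
  rw [← Fintype.sum_prod_type' fun x w =>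
    uniform (Fin n → G) x * wordProb d (-x + w) * (T x)ᶜ.indicator 1 w]
  exact Equiv.sum_comp (Equiv.arrowProdEquivProdArrow (Fin n) (fun _ => G) (fun _ => G))
    fun a => uniform (Fin n → G) a.1 * wordProb d (-a.1 + a.2) * (T a.1)ᶜ.indicator 1 a.2

theorem card_word_mul_rpow (n : ℕ) (h : ℝ) :
    (Fintype.card (Fin n → G) : ℝ) * 2 ^ (-(n * h)) =
      2 ^ (n * (Real.logb 2 (Fintype.card G) - h)) := by
  rw [mul_sub, sub_eq_add_neg, Real.rpow_add two_pos, mul_comm (n : ℝ) (Real.logb _ _),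
    Real.rpow_mul two_pos.le, Real.rpow_logb two_pos (by norm_num)
      (Nat.cast_pos.2 Fintype.card_pos), Real.rpow_natCast]
  simp

theorem tendsto_uncoveredProb {q d : G → ℝ} (hq : q ∈ stdSimplex ℝ G) (hd : d ∈ stdSimplex ℝ G)
    {M₀ M₁ : ℕ → ℕ} {R₀ R₁ : ℝ} (hM₀ : HasRate M₀ R₀) (hM₁ : HasRate M₁ R₁)
    (hR : Real.logb 2 (Fintype.card G) - entropy d < R₀ + R₁)
    (hR₀ : Real.logb 2 (Fintype.card G) - entropy (subLaw q d) < R₀)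
    {T : ∀ n, (Fin n → G) → Set (Fin n → G)}
    (hT : Tendsto (fun n => prob (wordProb (addNoiseLaw d))
      {ω : Fin n → G × G | Prod.snd ∘ ω ∉ T n (Prod.fst ∘ ω)}) atTop (𝓝 0)) :
    Tendsto (fun n => uncoveredProb (wordProb q) (M₀ n) (M₁ n) (T n)) atTop (𝓝 0) := by
  obtain ⟨h₁, hRh₁, hh₁⟩ := exists_between (sub_lt_comm.1 hR)
  obtain ⟨h₂, hRh₂, hh₂⟩ := exists_between (sub_lt_comm.1 hR₀)
  have hbad := (hT.add (tendsto_prob_rpow_lt_wordProb hd hh₁)).add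
    (tendsto_prob_rpow_lt_wordProb (subLaw_mem_stdSimplex hq hd) hh₂)
  have hfactor := (((hM₀.mul hM₁).tendsto_rpow_div (sub_lt_comm.1 hRh₁)).const_add 1).add
    (hM₀.tendsto_rpow_div (sub_lt_comm.1 hRh₂))
  have hlim := (hbad.const_sub 1).div hfactor (by norm_num)
  refine squeeze_zero (fun n => uncoveredProb_nonneg (wordProb_mem_stdSimplex hq) _ _ _)
    (fun n => ?_) (by simpa using hlim.const_sub 1)
  have hcover := one_sub_le_one_sub_uncoveredProb_mul (wordProb_mem_stdSimplex (n := n) hq)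
    (wordProb_mem_stdSimplex hd) (T n) (β₁ := 2 ^ (-(n * h₁))) (β₂ := 2 ^ (-(n * h₂)))
    (by positivity) (by positivity) (hM₀.1 n).ne' (hM₁.1 n).ne'
  rw [card_word_mul_rpow, card_word_mul_rpow, ← prob_wordProb_addNoiseLaw, subLaw_wordProb,
    ← div_le_iff₀ (by positivity)] at hcover
  simp only [sub_sub] at hcover
  exact le_sub_comm.1 hcover

end AsymptoticCovering

section TestChannel

variable {G : Type*} [AddGroup G] [Fintype G]

theorem sourceLaw_eq_uniform {p : G → ℝ} (hp : ∑ g, p g = 1) : sourceLaw p = uniform G := by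
  funext g
  simp only [sourceLaw, conv, uniform]
  rw [← Finset.mul_sum, sum_neg_add_right, hp, mul_one]

theorem continuous_entropy {α : Type*} [Fintype α] : Continuous (entropy : (α → ℝ) → ℝ) := by
  unfold entropy
  fun_prop

theorem entropy_uniform (α : Type*) [Fintype α] [Nonempty α] :
    entropy (uniform α) = Real.logb 2 (Fintype.card α) := by
  rw [entropy_eq_mean]
  simp only [uniform, one_div, Real.logb_inv, neg_neg]
  exact mean_const (uniform_mem_stdSimplex α).2 _

theorem entropy_subLaw_of_symm (q : G → ℝ) {d : G → ℝ} (hd : ∀ g, d (-g) = d g) :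
    entropy (subLaw q d) = entropy (conv q d) := by
  have hneg (g : G) : subLaw q d g = conv q d (-g) :=
    Finset.sum_congr rfl fun c _ => by rw [← hd, neg_add_rev]
  simp only [entropy, hneg]
  exact Equiv.sum_comp (Equiv.neg G) fun g => Real.negMulLog (conv q d g) / Real.log 2

theorem continuous_conv (q : G → ℝ) : Continuous (conv q) := by
  unfold conv
  fun_prop

theorem mean_addNoiseLaw_neg_add (d φ : G → ℝ) :
    mean (addNoiseLaw d) (fun a => φ (-a.1 + a.2)) = mean d φ := by
  calc mean (addNoiseLaw d) (fun a => φ (-a.1 + a.2))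
    _ = mean (uniform G) fun x => mean (fun w => d (-x + w)) fun w => φ (-x + w) := by
      simp only [mean, addNoiseLaw, Fintype.sum_prod_type, Finset.mul_sum, mul_assoc]
    _ = mean d φ := by
      simp only [mean_neg_add]
      exact mean_const (uniform_mem_stdSimplex G).2 _

theorem addNoiseLaw_mem_stdSimplex {d : G → ℝ} (hd : d ∈ stdSimplex ℝ G) :
    addNoiseLaw d ∈ stdSimplex ℝ (G × G) := by
  refine ⟨fun a => mul_nonneg ((uniform_mem_stdSimplex G).1 _) (hd.1 _), ?_⟩
  simpa [mean, hd.2] using mean_addNoiseLaw_neg_add d 1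

theorem sum_addNoiseLaw_fst {d : G → ℝ} (hd : ∑ g, d g = 1) (x : G) :
    ∑ w, addNoiseLaw d (x, w) = uniform G x := by
  simp only [addNoiseLaw, ← Finset.mul_sum, sum_neg_add_left, hd, mul_one]

theorem sum_addNoiseLaw_snd {d : G → ℝ} (hd : ∑ g, d g = 1) (w : G) :
    ∑ x, addNoiseLaw d (x, w) = uniform G w := by
  simp only [addNoiseLaw, uniform, ← Finset.mul_sum, sum_neg_add_right, hd, mul_one]

theorem entropy_addNoiseLaw {d : G → ℝ} (hd : ∑ g, d g = 1) :
    entropy (addNoiseLaw d) = entropy (uniform G) + entropy d := by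
  have hu : ∑ x, uniform G x = 1 := (uniform_mem_stdSimplex G).2
  simp only [entropy, ← Finset.sum_div, ← add_div]
  congr 1
  simp only [addNoiseLaw, Fintype.sum_prod_type, Real.negMulLog_mul, Finset.sum_add_distrib,
    ← Finset.sum_mul, ← Finset.mul_sum, sum_neg_add_left, hd, one_mul,
    sum_neg_add_left fun g => Real.negMulLog (d g), hu]

theorem mutualInfo_addNoiseLaw {d : G → ℝ} (hd : ∑ g, d g = 1) :
    mutualInfo (addNoiseLaw d) = entropy (uniform G) - entropy d := by
  simp only [mutualInfo, sum_addNoiseLaw_fst hd, sum_addNoiseLaw_snd hd, entropy_addNoiseLaw hd]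
  ring

end TestChannel

section ExpectedDistortion

variable {α : Type*} [Fintype α] [DecidableEq α]

/-- The expected Hamming distortion `Pr(X ≠ X̂)` of a pair `(X, X̂)` with joint law `J`. -/
def expectedDistortion (J : α × α → ℝ) : ℝ :=
  ∑ a : α × α, if a.1 ≠ a.2 then J a else 0

theorem expectedDistortion_eq_mean (J : α × α → ℝ) :
    expectedDistortion J = mean J fun a => if a.1 = a.2 then 0 else 1 := by
  simp only [expectedDistortion, mean, mul_ite, mul_zero, mul_one, ite_not]

theorem mean_ite_eq {J : α × α → ℝ} (hJ : ∑ a, J a = 1) (A B : ℝ) :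
    mean J (fun a => if a.1 = a.2 then A else B) =
      (1 - expectedDistortion J) * A + expectedDistortion J * B := by
  have hite (a : α × α) :
      (if a.1 = a.2 then A else B) = A + (B - A) * if a.1 = a.2 then 0 else 1 := by
    split_ifs <;> ring
  simp only [hite]
  rw [mean_add, mean_const hJ, mean_const_mul, ← expectedDistortion_eq_mean]
  ring

theorem le_expectedDistortion {J : α × α → ℝ} (hJ : ∀ a, 0 ≤ J a) {a : α × α} (ha : a.1 ≠ a.2) :
    J a ≤ expectedDistortion J := by
  have hterm : ∀ b ∈ Finset.univ, 0 ≤ if b.1 ≠ b.2 then J b else 0 := fun b _ => by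
    split_ifs
    exacts [hJ b, le_rfl]
  simpa only [expectedDistortion, if_pos ha] using Finset.single_le_sum hterm (Finset.mem_univ a)

end ExpectedDistortion

section DistortionLaw

variable {G : Type*} [AddGroup G] [Fintype G] [DecidableEq G]

theorem testLaw_eq_addNoiseLaw {p : G → ℝ} (hp : ∑ g, p g = 1) (D : ℝ) :
    testLaw p D = addNoiseLaw (distortionLaw G D) := by
  funext a
  rw [testLaw, sourceLaw_eq_uniform hp, addNoiseLaw]

theorem distortionLaw_neg (D : ℝ) (g : G) : distortionLaw G D (-g) = distortionLaw G D g := by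
  simp only [distortionLaw, neg_eq_zero]

theorem continuous_distortionLaw : Continuous (distortionLaw G) := by
  refine continuous_pi fun g => ?_
  unfold distortionLaw
  split_ifs <;> fun_prop

theorem continuous_testLaw (p : G → ℝ) : Continuous (testLaw p) :=
  continuous_pi fun a =>
    continuous_const.mul ((continuous_apply (-a.1 + a.2)).comp continuous_distortionLaw)

theorem mean_distortionLaw_ite [Nontrivial G] (D A B : ℝ) :
    mean (distortionLaw G D) (fun g => if g = 0 then A else B) = (1 - D) * A + D * B := by
  have hcard : (Fintype.card G : ℝ) - 1 ≠ 0 :=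
    sub_ne_zero.2 (Nat.one_lt_cast.2 Fintype.one_lt_card).ne'
  have hne : ∀ g ∈ Finset.univ.erase (0 : G),
      distortionLaw G D g * (if g = 0 then A else B) = D / (Fintype.card G - 1) * B := by
    intro g hg
    simp only [distortionLaw, if_neg (Finset.ne_of_mem_erase hg)]
  rw [mean, ← Finset.add_sum_erase _ _ (Finset.mem_univ (0 : G)), Finset.sum_congr rfl hne,
    Finset.sum_const, Finset.card_erase_of_mem (Finset.mem_univ _), Finset.card_univ,
    nsmul_eq_mul, Nat.cast_pred Fintype.card_pos, distortionLaw, if_pos rfl, if_pos rfl]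
  field_simp

theorem distortionLaw_mem_stdSimplex [Nontrivial G] {D : ℝ} (hD : D ∈ Set.Icc 0 1) :
    distortionLaw G D ∈ stdSimplex ℝ G := by
  have hcard : (1 : ℝ) < Fintype.card G := Nat.one_lt_cast.2 Fintype.one_lt_card
  refine ⟨fun g => ?_, by simpa [mean] using mean_distortionLaw_ite (G := G) D 1 1⟩
  unfold distortionLaw
  split_ifs
  · exact sub_nonneg.2 hD.2
  · exact div_nonneg hD.1 (sub_nonneg.2 hcard.le)

theorem testLaw_mem_stdSimplex [Nontrivial G] {p : G → ℝ} (hp : ∑ g, p g = 1) {D : ℝ}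
    (hD : D ∈ Set.Icc 0 1) : testLaw p D ∈ stdSimplex ℝ (G × G) := by
  rw [testLaw_eq_addNoiseLaw hp]
  exact addNoiseLaw_mem_stdSimplex (distortionLaw_mem_stdSimplex hD)

theorem expectedDistortion_testLaw [Nontrivial G] {p : G → ℝ} (hp : ∑ g, p g = 1) (D : ℝ) :
    expectedDistortion (testLaw p D) = D := by
  rw [expectedDistortion_eq_mean, testLaw_eq_addNoiseLaw hp]
  simpa only [neg_add_eq_zero, mean_distortionLaw_ite, mul_zero, mul_one, zero_add] using
    mean_addNoiseLaw_neg_add (distortionLaw G D) fun g => if g = 0 then 0 else 1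

theorem testLaw_pos [Nontrivial G] {p : G → ℝ} (hp : ∑ g, p g = 1) {D : ℝ}
    (hD : D ∈ Set.Ioo 0 1) (a : G × G) : 0 < testLaw p D a := by
  have hcard : (1 : ℝ) < Fintype.card G := Nat.one_lt_cast.2 Fintype.one_lt_card
  rw [testLaw_eq_addNoiseLaw hp, addNoiseLaw, uniform, distortionLaw]
  refine mul_pos (by positivity) ?_
  split_ifs
  exacts [sub_pos.2 hD.2, div_pos hD.1 (sub_pos.2 hcard)]

end DistortionLaw

section RateDistortion

theorem entropy_le_mean_neg_logb {β : Type*} [Fintype β] {J K : β → ℝ} (hJ : J ∈ stdSimplex ℝ β)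
    (hK : K ∈ stdSimplex ℝ β) (hac : ∀ b, K b = 0 → J b = 0) :
    entropy J ≤ mean J fun b => -Real.logb 2 (K b) := by
  have hlog2 : 0 < Real.log 2 := Real.log_pos one_lt_two
  have hterm (b : β) :
      Real.negMulLog (J b) / Real.log 2 ≤
        J b * -Real.logb 2 (K b) + (K b - J b) / Real.log 2 := by
    rcases (hJ.1 b).eq_or_lt with hJb | hJb
    · simpa [← hJb] using div_nonneg (hK.1 b) hlog2.le
    have hKb : 0 < K b := (hK.1 b).lt_of_ne' fun h => hJb.ne' (hac b h)
    have hlog := mul_le_mul_of_nonneg_left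
      (Real.log_le_sub_one_of_pos (div_pos hKb hJb)) hJb.le
    rw [Real.log_div hKb.ne' hJb.ne', mul_sub, mul_sub, mul_div_cancel₀ _ hJb.ne'] at hlog
    rw [Real.logb, ← neg_div, ← mul_div_assoc, ← add_div, Real.negMulLog]
    gcongr
    linarith
  calc entropy J
    _ ≤ ∑ b, (J b * -Real.logb 2 (K b) + (K b - J b) / Real.log 2) :=
      Finset.sum_le_sum fun b _ => hterm b
    _ = mean J fun b => -Real.logb 2 (K b) := by
      rw [Finset.sum_add_distrib, ← Finset.sum_div, Finset.sum_sub_distrib, hJ.2, hK.2, mean]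
      simp

/-- `V (·, b)` is a candidate for the conditional law of the first coordinate given that the second
one is `b`. -/
theorem entropy_le_entropy_snd_add_mean {α β : Type*} [Fintype α] [Fintype β]
    {J V : α × β → ℝ} (hJ : J ∈ stdSimplex ℝ (α × β)) (hV : ∀ a, 0 ≤ V a)
    (hV1 : ∀ b, ∑ a, V (a, b) = 1) (hac : ∀ a, V a = 0 → J a = 0) :
    entropy J ≤ entropy (fun b => ∑ a, J (a, b)) + mean J fun a => -Real.logb 2 (V a) := by
  set Q : β → ℝ := fun b => ∑ a, J (a, b) with hQ
  have hQ_nonneg (b : β) : 0 ≤ Q b := Finset.sum_nonneg fun a _ => hJ.1 (a, b)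
  have hQ_ac (a : α × β) (h : Q a.2 = 0) : J a = 0 :=
    (Finset.sum_eq_zero_iff_of_nonneg fun x _ => hJ.1 (x, a.2)).1 h a.1 (Finset.mem_univ _)
  have hprod : (fun a => Q a.2 * V a) ∈ stdSimplex ℝ (α × β) := by
    refine ⟨fun a => mul_nonneg (hQ_nonneg _) (hV a), ?_⟩
    simp only [Fintype.sum_prod_type_right, ← Finset.mul_sum, hV1, mul_one]
    rw [← hJ.2, Fintype.sum_prod_type_right]
  have hsnd : mean J (fun a => -Real.logb 2 (Q a.2)) = entropy Q := by
    simp only [entropy_eq_mean, mean, Fintype.sum_prod_type_right, ← Finset.sum_mul, hQ]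
  calc entropy J
    _ ≤ mean J fun a => -Real.logb 2 (Q a.2 * V a) :=
      entropy_le_mean_neg_logb hJ hprod fun a h => (mul_eq_zero.1 h).elim (hQ_ac a) (hac a)
    _ = mean J fun a => -Real.logb 2 (Q a.2) + -Real.logb 2 (V a) :=
      Finset.sum_congr rfl fun a _ => by
        by_cases hJa : J a = 0
        · rw [hJa, zero_mul, zero_mul]
        · simp only [Real.logb_mul (mt (hQ_ac a) hJa) (mt (hac a) hJa), neg_add]
    _ = entropy Q + mean J fun a => -Real.logb 2 (V a) := by rw [mean_add, hsnd]

theorem div_sub_one_le_one_sub {N D : ℝ} (hN : 1 < N) (hD : D ≤ 1 - 1 / N) :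
    D / (N - 1) ≤ 1 - D := by
  have hmul := mul_le_mul_of_nonneg_right hD (zero_le_one.trans hN.le)
  rw [sub_mul, one_div_mul_cancel (zero_lt_one.trans hN).ne'] at hmul
  rw [div_le_iff₀ (sub_pos.2 hN)]
  linarith

variable {G : Type*} [AddGroup G] [Fintype G] [DecidableEq G]

theorem distortionLaw_neg_add (D : ℝ) (x w : G) :
    distortionLaw G D (-x + w) = if x = w then 1 - D else D / (Fintype.card G - 1) := by
  simp only [distortionLaw, neg_add_eq_zero]

theorem mean_neg_logb_distortionLaw {J : G × G → ℝ} (hJ : ∑ a, J a = 1) (D : ℝ) :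
    mean J (fun a => -Real.logb 2 (distortionLaw G D (-a.1 + a.2))) =
      (1 - expectedDistortion J) * -Real.logb 2 (1 - D) +
        expectedDistortion J * -Real.logb 2 (D / (Fintype.card G - 1)) := by
  rw [← mean_ite_eq hJ]
  simp only [distortionLaw_neg_add, apply_ite (Real.logb 2), neg_ite]

theorem entropy_distortionLaw [Nontrivial G] (D : ℝ) :
    entropy (distortionLaw G D) =
      (1 - D) * -Real.logb 2 (1 - D) + D * -Real.logb 2 (D / (Fintype.card G - 1)) := by
  rw [entropy_eq_mean, ← mean_distortionLaw_ite (G := G)]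
  simp only [distortionLaw, apply_ite (Real.logb 2), neg_ite]

theorem entropy_le_entropy_snd_add_entropy_distortionLaw [Nontrivial G] {D : ℝ} (hD0 : 0 ≤ D)
    (hD : D ≤ 1 - 1 / (Fintype.card G : ℝ)) {J : G × G → ℝ} (hJ : J ∈ stdSimplex ℝ (G × G))
    (hJD : expectedDistortion J ≤ D) :
    entropy J ≤ entropy (fun b => ∑ a, J (a, b)) + entropy (distortionLaw G D) := by
  have hcard : (1 : ℝ) < Fintype.card G := Nat.one_lt_cast.2 Fintype.one_lt_card
  have hD1 : D < 1 := hD.trans_lt (sub_lt_self _ (by positivity))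
  have hd := distortionLaw_mem_stdSimplex (G := G) ⟨hD0, hD1.le⟩
  have hac (a : G × G) (h : distortionLaw G D (-a.1 + a.2) = 0) : J a = 0 := by
    rw [distortionLaw_neg_add] at h
    split_ifs at h with ha
    · linarith
    · have hDzero := (div_eq_zero_iff.1 h).resolve_right (sub_pos.2 hcard).ne'
      exact le_antisymm (((le_expectedDistortion hJ.1 ha).trans hJD).trans hDzero.le) (hJ.1 a)
  have hfano := entropy_le_entropy_snd_add_mean hJ (fun a => hd.1 (-a.1 + a.2))
    (fun b => (sum_neg_add_right _ b).trans hd.2) hac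
  rw [mean_neg_logb_distortionLaw hJ.2] at hfano
  have hmono : (D - expectedDistortion J) * Real.logb 2 (D / (Fintype.card G - 1)) ≤
      (D - expectedDistortion J) * Real.logb 2 (1 - D) := by
    rcases hD0.eq_or_lt with rfl | hpos
    · have hzero : expectedDistortion J = 0 := hJD.antisymm <| by
        rw [expectedDistortion_eq_mean]
        exact mean_nonneg hJ.1 fun a => by split_ifs <;> norm_num
      simp only [hzero, sub_zero, zero_mul, le_refl]
    · exact mul_le_mul_of_nonneg_left (Real.logb_le_logb_of_le one_lt_two
        (div_pos hpos (sub_pos.2 hcard)) (div_sub_one_le_one_sub hcard hD)) (sub_nonneg.2 hJD)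
  rw [entropy_distortionLaw]
  linarith

theorem isLeast_achievableInfo [Nontrivial G] {p : G → ℝ} (hp : ∑ g, p g = 1) {D : ℝ}
    (hD0 : 0 ≤ D) (hD : D ≤ 1 - 1 / (Fintype.card G : ℝ)) :
    IsLeast (achievableInfo (sourceLaw p) D)
      (entropy (sourceLaw p) - entropy (distortionLaw G D)) := by
  have hD01 : D ∈ Set.Icc 0 1 := ⟨hD0, hD.trans (sub_le_self _ (by positivity))⟩
  have hd : ∑ g, distortionLaw G D g = 1 := (distortionLaw_mem_stdSimplex hD01).2
  constructor
  · refine ⟨testLaw p D, testLaw_mem_stdSimplex hp hD01, fun x => ?_,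
      (expectedDistortion_testLaw hp D).le, ?_⟩ <;>
      rw [testLaw_eq_addNoiseLaw hp, sourceLaw_eq_uniform hp]
    · exact sum_addNoiseLaw_fst hd x
    · exact (mutualInfo_addNoiseLaw hd).symm
  · rintro I ⟨J, hJ, hfst, hJD, rfl⟩
    have hfano := entropy_le_entropy_snd_add_entropy_distortionLaw hD0 hD hJ hJD
    simp only [mutualInfo, hfst]
    linarith

end RateDistortion

section Typicality

variable {α : Type*} [DecidableEq α] {n : ℕ}

theorem pairCount_div_eq_empiricalMean (ω : Fin n → α × α) (a : α × α) :
    (pairCount (Prod.fst ∘ ω) (Prod.snd ∘ ω) a : ℝ) / n =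
      empiricalMean (fun b => if b = a then 1 else 0) ω := by
  simp [pairCount, empiricalMean_eq_div]

theorem hammingDist_div_eq_empiricalMean (ω : Fin n → α × α) :
    (hammingDist (Prod.fst ∘ ω) (Prod.snd ∘ ω) : ℝ) / n =
      empiricalMean (fun a => if a.1 = a.2 then 0 else 1) ω := by
  simp [hammingDist, empiricalMean_eq_div, Finset.sum_ite]

theorem hammingDist_div_le_one (x w : Fin n → α) : (hammingDist x w : ℝ) / n ≤ 1 := by
  refine div_le_one_of_le₀ (Nat.cast_le.2 ?_) n.cast_nonneg
  simpa using hammingDist_le_card_fintype (x := x) (y := w)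

variable [Fintype α] {J : α × α → ℝ} {ε : ℝ} {x w : Fin n → α}

theorem hammingDist_eq_sum_pairCount (x w : Fin n → α) :
    hammingDist x w = ∑ a : α × α, if a.1 ≠ a.2 then pairCount x w a else 0 := by
  rw [hammingDist, Finset.card_eq_sum_card_fiberwise (f := fun k => (x k, w k))
    (t := Finset.univ.filter fun a : α × α => a.1 ≠ a.2) (by simp [Set.MapsTo]),
    Finset.sum_filter]
  refine Finset.sum_congr rfl fun a _ => ?_
  split_ifs with ha
  · rw [pairCount, Finset.filter_filter]
    congr 1
    ext k
    simp only [Finset.mem_filter, Finset.mem_univ, true_and, and_iff_right_iff_imp]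
    rintro rfl
    exact ha
  · rfl

theorem JointlyTypical.hammingDist_div_le (h : JointlyTypical J ε x w) (hJ : ∀ a, 0 ≤ J a)
    (hε : 0 ≤ ε) : (hammingDist x w : ℝ) / n ≤ expectedDistortion J + ε := by
  have hslack : 0 ≤ ε / (Fintype.card α : ℝ) ^ 2 := by positivity
  have hfreq (a : α × α) :
      (pairCount x w a : ℝ) / n ≤ J a + ε / (Fintype.card α : ℝ) ^ 2 := by
    rcases (hJ a).eq_or_lt with hzero | hpos
    · rw [(h a).2 hzero.symm, ← hzero, Nat.cast_zero, zero_div, zero_add]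
      exact hslack
    · linarith [(abs_lt.1 ((h a).1 hpos)).2]
  calc (hammingDist x w : ℝ) / n
    _ = ∑ a : α × α, if a.1 ≠ a.2 then (pairCount x w a : ℝ) / n else 0 := by
      rw [hammingDist_eq_sum_pairCount, Nat.cast_sum, Finset.sum_div]
      exact Finset.sum_congr rfl fun a _ => by split_ifs <;> simp
    _ ≤ ∑ a : α × α, ((if a.1 ≠ a.2 then J a else 0) + ε / (Fintype.card α : ℝ) ^ 2) :=
      Finset.sum_le_sum fun a _ => by
        split_ifs
        exacts [hfreq a, by rwa [zero_add]]
    _ = expectedDistortion J + ε * ((Fintype.card α : ℝ) ^ 2 / (Fintype.card α : ℝ) ^ 2) := by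
      rw [Finset.sum_add_distrib, Finset.sum_const, Finset.card_univ, Fintype.card_prod,
        nsmul_eq_mul, Nat.cast_mul, ← sq, mul_div_left_comm, expectedDistortion]
    _ ≤ expectedDistortion J + ε := by
      gcongr
      exact mul_le_of_le_one_right hε (div_self_le_one _)

theorem JointlyTypical.eq (h : JointlyTypical J ε x w) (hJ : ∀ a, a.1 ≠ a.2 → J a = 0) :
    x = w := by
  funext k
  by_contra hne
  have hempty := Finset.card_eq_zero.1 ((h (x k, w k)).2 (hJ _ hne))
  exact Finset.filter_eq_empty_iff.1 hempty (Finset.mem_univ k) rfl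

theorem tendsto_prob_not_jointlyTypical {P : α × α → ℝ} (hP : P ∈ stdSimplex ℝ (α × α))
    (hclose : ∀ a, |P a - J a| < ε / (Fintype.card α : ℝ) ^ 2) (hac : ∀ a, J a = 0 → P a = 0) :
    Tendsto (fun n => prob (wordProb P)
      {ω : Fin n → α × α | ¬JointlyTypical J ε (Prod.fst ∘ ω) (Prod.snd ∘ ω)}) atTop (𝓝 0) := by
  have hmem (a : α × α) : Metric.ball (J a) (ε / (Fintype.card α : ℝ) ^ 2) ∈
      𝓝 (mean P fun b => if b = a then 1 else 0) :=
    Metric.isOpen_ball.mem_nhds (by simpa [mean, Real.dist_eq] using hclose a)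
  have hlim := tendsto_finsetSum Finset.univ fun a _ =>
    tendsto_prob_empiricalMean_notMem hP (hmem a)
  rw [Finset.sum_const_zero] at hlim
  have hword (n : ℕ) := wordProb_mem_stdSimplex (n := n) hP
  refine squeeze_zero (fun n => prob_nonneg (hword n).1 _) (fun n => ?_) hlim
  refine (prob_mono (hword n).1 fun ω hω hntyp => ?_).trans (prob_iUnion_le (hword n).1 _)
  by_contra hball
  refine hntyp fun a => ⟨fun _ => ?_, fun ha => ?_⟩
  · rw [pairCount_div_eq_empiricalMean, ← Real.dist_eq, ← Metric.mem_ball]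
    exact not_not.1 fun hout => hball (Set.mem_iUnion.2 ⟨a, hout⟩)
  · refine Finset.card_eq_zero.2 (Finset.filter_eq_empty_iff.2 fun k _ hk => ?_)
    have hωk : P (ω k) ≠ 0 := Finset.prod_ne_zero_iff.1 hω k (Finset.mem_univ k)
    exact hωk (hac _ (by rwa [show ω k = a from hk]))

end Typicality

section Encoder

theorem mean_uniform_mean_add {W : Type*} [AddGroup W] [Fintype W] {v : W → ℝ}
    (hv : ∑ z, v z = 1) (f : W → ℝ) :
    mean (uniform W) (fun y => mean v fun z => f (y + z)) = mean (uniform W) f := by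
  have hshift (z : W) : mean (uniform W) (fun y => f (y + z)) = mean (uniform W) f := by
    simp only [mean_uniform, ← Equiv.sum_comp (Equiv.addRight z) f, Equiv.coe_addRight]
  rw [mean_comm]
  simp only [hshift, mean_const hv]

theorem codeProb_mem_stdSimplex {α : Type*} [Fintype α] {P : α → ℝ} (hP : P ∈ stdSimplex ℝ α)
    (n M : ℕ) : codeProb P ∈ stdSimplex ℝ (Code α n M) := by
  classical exact wordProb_mem_stdSimplex (wordProb_mem_stdSimplex hP)

variable {G : Type*} [AddGroup G] [Fintype G] [DecidableEq G] {p q : G → ℝ} {n M₀ M₁ : ℕ}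

theorem encoderErrorProb_eq_mean (hp : ∑ g, p g = 1) (q : G → ℝ) (enc : Encoder G n M₀ M₁)
    (t : ℝ) :
    encoderErrorProb p q enc t = mean (uniform (Fin n → G)) fun x =>
      mean (prodLaw (codeProb (uniform G)) (codeProb q)) fun c =>
        prob (enc c.1 c.2 x) {s | t < (hammingDist x (c.1 s.1 + c.2 s.2) : ℝ) / n} := by
  rw [← mean_uniform_mean_add (sum_wordProb hp), ← wordProb_uniform]
  simp only [mean_prodLaw]
  simp only [mean, prob, encoderErrorProb, Finset.mul_sum, mul_assoc,
    Set.indicator_apply, Set.mem_ofPred_eq, Pi.one_apply, mul_ite, mul_one, mul_zero]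

variable {enc : Encoder G n M₀ M₁}

theorem encoderErrorProb_nonneg (hp : ∑ g, p g = 1) (hq : q ∈ stdSimplex ℝ G)
    (henc : ∀ c₀ c₁ x s, 0 ≤ enc c₀ c₁ x s) (t : ℝ) : 0 ≤ encoderErrorProb p q enc t := by
  have hcode := prodLaw_mem_stdSimplex
    (codeProb_mem_stdSimplex (uniform_mem_stdSimplex G) n M₀) (codeProb_mem_stdSimplex hq n M₁)
  rw [encoderErrorProb_eq_mean hp]
  exact mean_nonneg (uniform_mem_stdSimplex _).1 fun x =>
    mean_nonneg hcode.1 fun c => prob_nonneg (henc c.1 c.2 x) _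

theorem encoderErrorProb_le_uncoveredProb (hp : ∑ g, p g = 1) (hq : q ∈ stdSimplex ℝ G)
    (henc : ∀ c₀ c₁ x, enc c₀ c₁ x ∈ stdSimplex ℝ (Fin M₀ × Fin M₁)) {t : ℝ}
    {T : (Fin n → G) → Set (Fin n → G)}
    (hT : ∀ c₀ c₁ x, (∃ s : Fin M₀ × Fin M₁, c₀ s.1 + c₁ s.2 ∈ T x) →
      ∀ s, enc c₀ c₁ x s ≠ 0 → (hammingDist x (c₀ s.1 + c₁ s.2) : ℝ) / n ≤ t) :
    encoderErrorProb p q enc t ≤ uncoveredProb (wordProb q) M₀ M₁ T := by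
  have hcode := prodLaw_mem_stdSimplex
    (codeProb_mem_stdSimplex (uniform_mem_stdSimplex G) n M₀) (codeProb_mem_stdSimplex hq n M₁)
  rw [encoderErrorProb_eq_mean hp, uncoveredProb, ← wordProb_uniform]
  refine mean_mono (wordProb_mem_stdSimplex (uniform_mem_stdSimplex G)).1 fun x _ =>
    mean_mono hcode.1 fun c _ => ?_
  by_cases hcover : ∃ s : Fin M₀ × Fin M₁, c.1 s.1 + c.2 s.2 ∈ T x
  · refine (prob_mono (T := ∅) (henc _ _ _).1 fun s hs hlt => ?_).trans
      ((prob_empty _).le.trans (indicator_one_nonneg _ _))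
    exact (hT _ _ _ hcover s hs).not_gt hlt
  · rw [Set.indicator_of_mem hcover, Pi.one_apply]
    exact prob_le_one (henc _ _ _) _

theorem exists_mem_stdSimplex_of_priority {ι : Type*} [Fintype ι] [Nonempty ι]
    (Typ Good : ι → Prop) :
    ∃ e ∈ stdSimplex ℝ ι, ((∃ s, Typ s) → ∀ s, e s ≠ 0 → Typ s) ∧
      ((¬∃ s, Typ s) → e = uniform ι) ∧
      ((∃ s, Typ s ∧ Good s) → ∀ s, e s ≠ 0 → Good s) := by
  classical
  by_cases htyp : ∃ s, Typ s
  · obtain ⟨s₀, hs₀, hgood⟩ : ∃ s₀, Typ s₀ ∧ ((∃ s, Typ s ∧ Good s) → Good s₀) := by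
      by_cases hgood : ∃ s, Typ s ∧ Good s
      · exact hgood.imp fun s hs => ⟨hs.1, fun _ => hs.2⟩
      · exact htyp.imp fun s hs => ⟨hs, fun h => absurd h hgood⟩
    have hsupp (s : ι) (hs : (Pi.single s₀ 1 : ι → ℝ) s ≠ 0) : s = s₀ :=
      not_not.1 fun hne => hs (Pi.single_eq_of_ne hne 1)
    exact ⟨Pi.single s₀ 1, single_mem_stdSimplex ℝ s₀, fun _ s hs => hsupp s hs ▸ hs₀,
      fun h => absurd htyp h, fun h s hs => hsupp s hs ▸ hgood h⟩
  · exact ⟨uniform ι, uniform_mem_stdSimplex ι, fun h => absurd h htyp, fun _ => rfl,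
      fun ⟨s, hs⟩ => absurd ⟨s, hs.1⟩ htyp⟩

theorem exists_isTypicalEncoder_of_priority (J : G × G → ℝ) (ε : ℝ) (hM₀ : 0 < M₀) (hM₁ : 0 < M₁)
    (Good : (Fin n → G) → (Fin n → G) → Prop) :
    ∃ enc : Encoder G n M₀ M₁, IsTypicalEncoder J ε enc ∧ ∀ c₀ c₁ x,
      (∃ s : Fin M₀ × Fin M₁, JointlyTypical J ε x (c₀ s.1 + c₁ s.2) ∧
        Good x (c₀ s.1 + c₁ s.2)) →
      ∀ s, enc c₀ c₁ x s ≠ 0 → Good x (c₀ s.1 + c₁ s.2) := by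
  have : Nonempty (Fin M₀ × Fin M₁) := ⟨(⟨0, hM₀⟩, ⟨0, hM₁⟩)⟩
  choose enc hlaw htyp hfall hgood using
    fun (c₀ : Code G n M₀) (c₁ : Code G n M₁) (x : Fin n → G) =>
      exists_mem_stdSimplex_of_priority
        (fun s : Fin M₀ × Fin M₁ => JointlyTypical J ε x (c₀ s.1 + c₁ s.2))
        fun s => Good x (c₀ s.1 + c₁ s.2)
  exact ⟨enc, ⟨hlaw, htyp, hfall⟩, hgood⟩

end Encoder

section Achievability

variable {G : Type*} [AddGroup G] [Fintype G] [DecidableEq G] {p q : G → ℝ} {D ε R₀ R₁ : ℝ}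
  {M₀ M₁ : ℕ → ℕ} {n : ℕ} {x w : Fin n → G}

/-- The noise levels `D` at which the rates `R₀`, `R₁` exceed both thresholds of the superposition
code whose second layer has letters of law `q`, for a uniform source. -/
def admissibleLevels (q : G → ℝ) (R₀ R₁ : ℝ) : Set ℝ :=
  {D | Real.logb 2 (Fintype.card G) - entropy (conv q (distortionLaw G D)) < R₀ ∧
    Real.logb 2 (Fintype.card G) - entropy (distortionLaw G D) < R₀ + R₁}

theorem isOpen_admissibleLevels (q : G → ℝ) (R₀ R₁ : ℝ) : IsOpen (admissibleLevels q R₀ R₁) := by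
  have hconv := continuous_entropy.comp ((continuous_conv q).comp continuous_distortionLaw)
  have hnoise := continuous_entropy.comp (continuous_distortionLaw (G := G))
  exact (isOpen_lt (continuous_const.sub hconv) continuous_const).inter
    (isOpen_lt (continuous_const.sub hnoise) continuous_const)

theorem tendsto_encoderErrorProb [Nontrivial G] (hp : ∑ g, p g = 1) (hq : q ∈ stdSimplex ℝ G)
    (hD : D ∈ Set.Icc 0 1) (hR : D ∈ admissibleLevels q R₀ R₁) (hM₀ : HasRate M₀ R₀)
    (hM₁ : HasRate M₁ R₁) {enc : ∀ n, Encoder G n (M₀ n) (M₁ n)}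
    (henc : ∀ n c₀ c₁ x, enc n c₀ c₁ x ∈ stdSimplex ℝ (Fin (M₀ n) × Fin (M₁ n))) {t : ℝ}
    {T : ∀ n, (Fin n → G) → Set (Fin n → G)}
    (hT : ∀ n c₀ c₁ x, (∃ s : Fin (M₀ n) × Fin (M₁ n), c₀ s.1 + c₁ s.2 ∈ T n x) →
      ∀ s, enc n c₀ c₁ x s ≠ 0 → (hammingDist x (c₀ s.1 + c₁ s.2) : ℝ) / n ≤ t)
    (hlim : Tendsto (fun n => prob (wordProb (testLaw p D))
      {ω : Fin n → G × G | Prod.snd ∘ ω ∉ T n (Prod.fst ∘ ω)}) atTop (𝓝 0)) :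
    Tendsto (fun n => encoderErrorProb p q (enc n) t) atTop (𝓝 0) := by
  rw [testLaw_eq_addNoiseLaw hp] at hlim
  refine squeeze_zero
    (fun n => encoderErrorProb_nonneg hp hq (fun c₀ c₁ x => (henc n c₀ c₁ x).1) t)
    (fun n => encoderErrorProb_le_uncoveredProb hp hq (henc n) (hT n))
    (tendsto_uncoveredProb hq (distortionLaw_mem_stdSimplex hD) hM₀ hM₁ hR.2 ?_ hlim)
  rw [entropy_subLaw_of_symm q (distortionLaw_neg D)]
  exact hR.1

theorem tendsto_prob_not_jointlyTypical_testLaw [Nontrivial G] (hp : ∑ g, p g = 1)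
    (hD : D ∈ Set.Icc 0 1) (hε : 0 < ε) :
    Tendsto (fun n => prob (wordProb (testLaw p D)) {ω : Fin n → G × G |
      ¬JointlyTypical (testLaw p D) ε (Prod.fst ∘ ω) (Prod.snd ∘ ω)}) atTop (𝓝 0) :=
  tendsto_prob_not_jointlyTypical (testLaw_mem_stdSimplex hp hD)
    (fun a => by rw [sub_self, abs_zero]; positivity) fun _ h => h

theorem tendsto_encoderErrorProb_of_isTypicalEncoder [Nontrivial G] (hp : ∑ g, p g = 1)
    (hq : q ∈ stdSimplex ℝ G) (hD : D ∈ Set.Icc 0 1) (hR : D ∈ admissibleLevels q R₀ R₁)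
    (hM₀ : HasRate M₀ R₀) (hM₁ : HasRate M₁ R₁) (hε : 0 < ε)
    {enc : ∀ n, Encoder G n (M₀ n) (M₁ n)}
    (henc : ∀ n, IsTypicalEncoder (testLaw p D) ε (enc n)) {t : ℝ}
    (ht : ∀ n (x w : Fin n → G), JointlyTypical (testLaw p D) ε x w →
      (hammingDist x w : ℝ) / n ≤ t) :
    Tendsto (fun n => encoderErrorProb p q (enc n) t) atTop (𝓝 0) :=
  tendsto_encoderErrorProb hp hq hD hR hM₀ hM₁ (fun n => (henc n).isLaw)
    (T := fun _ x => {w | JointlyTypical (testLaw p D) ε x w})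
    (fun n c₀ c₁ x hs s h => ht n _ _ ((henc n).typical c₀ c₁ x hs s h))
    (tendsto_prob_not_jointlyTypical_testLaw hp hD hε)

theorem JointlyTypical.hammingDist_div_le_add [Nontrivial G] (hp : ∑ g, p g = 1)
    (hD : D ∈ Set.Icc 0 1) (hε : 0 ≤ ε) (h : JointlyTypical (testLaw p D) ε x w) :
    (hammingDist x w : ℝ) / n ≤ D + ε := by
  simpa only [expectedDistortion_testLaw hp] using
    h.hammingDist_div_le (testLaw_mem_stdSimplex hp hD).1 hε

theorem JointlyTypical.hammingDist_eq_zero (h : JointlyTypical (testLaw p 0) ε x w) :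
    hammingDist x w = 0 := by
  refine _root_.hammingDist_eq_zero.2 (h.eq fun a ha => ?_)
  rw [testLaw, distortionLaw_neg_add, if_neg ha, zero_div, mul_zero]

theorem JointlyTypical.hammingDist_div_le_of_max [Nontrivial G] (hp : ∑ g, p g = 1)
    (hD : D ∈ Set.Icc 0 1) (hε : 0 ≤ ε) (h : JointlyTypical (testLaw p (max 0 (D - ε))) ε x w) :
    (hammingDist x w : ℝ) / n ≤ D := by
  rcases le_total (D - ε) 0 with hle | hle
  · rw [max_eq_left hle] at h
    simpa only [h.hammingDist_eq_zero, Nat.cast_zero, zero_div] using hD.1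
  · rw [max_eq_right hle] at h
    simpa using h.hammingDist_div_le_add hp ⟨hle, (sub_le_self D hε).trans hD.2⟩ hε

theorem JointlyTypical.hammingDist_div_le_of_notMem_Ioo (hD : D ∈ Set.Icc 0 1)
    (hD' : D ∉ Set.Ioo 0 1) (h : JointlyTypical (testLaw p D) ε x w) :
    (hammingDist x w : ℝ) / n ≤ D := by
  rcases hD.1.eq_or_lt with rfl | hpos
  · rw [h.hammingDist_eq_zero, Nat.cast_zero, zero_div]
  · exact (hammingDist_div_le_one x w).trans (not_lt.1 fun hlt => hD' ⟨hpos, hlt⟩)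

theorem tendsto_prob_not_jointlyTypical_and_le [Nontrivial G] (hp : ∑ g, p g = 1) {D' : ℝ}
    (hD' : D' ∈ Set.Icc 0 1) (hlt : D' < D) {J : G × G → ℝ}
    (hclose : ∀ a, |testLaw p D' a - J a| < ε / (Fintype.card G : ℝ) ^ 2)
    (hac : ∀ a, J a = 0 → testLaw p D' a = 0) :
    Tendsto (fun n => prob (wordProb (testLaw p D'))
      {ω : Fin n → G × G | ¬(JointlyTypical J ε (Prod.fst ∘ ω) (Prod.snd ∘ ω) ∧
        (hammingDist (Prod.fst ∘ ω) (Prod.snd ∘ ω) : ℝ) / n ≤ D)}) atTop (𝓝 0) := by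
  have hlaw := testLaw_mem_stdSimplex hp hD'
  have hdist : Set.Iic D ∈ 𝓝 (mean (testLaw p D') fun a => if a.1 = a.2 then 0 else 1) := by
    rw [← expectedDistortion_eq_mean, expectedDistortion_testLaw hp]
    exact Iic_mem_nhds hlt
  have hlim := (tendsto_prob_not_jointlyTypical hlaw hclose hac).add
    (tendsto_prob_empiricalMean_notMem hlaw hdist)
  rw [add_zero] at hlim
  have hword (n : ℕ) := (wordProb_mem_stdSimplex (n := n) hlaw).1
  refine squeeze_zero (fun n => prob_nonneg (hword n) _) (fun n => ?_) hlim
  refine (prob_mono (hword n) fun ω _ hω => ?_).trans (prob_union_le (hword n) _ _)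
  rcases not_and_or.1 hω with htyp | hfar
  · exact Or.inl htyp
  · exact Or.inr (by rwa [hammingDist_div_eq_empiricalMean] at hfar)

/-- In the interior the noise level is lowered slightly, which leaves room for the law of large
numbers to meet the constraint `D` exactly. -/
theorem exists_level_tendsto_prob_not_jointlyTypical_and_le [Nontrivial G] (hp : ∑ g, p g = 1)
    (hD : D ∈ Set.Icc 0 1) (hε : 0 < ε) {C : Set ℝ} (hC : C ∈ 𝓝 D) :
    ∃ D' ∈ C, D' ∈ Set.Icc 0 1 ∧ Tendsto (fun n => prob (wordProb (testLaw p D'))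
      {ω : Fin n → G × G | ¬(JointlyTypical (testLaw p D) ε (Prod.fst ∘ ω) (Prod.snd ∘ ω) ∧
        (hammingDist (Prod.fst ∘ ω) (Prod.snd ∘ ω) : ℝ) / n ≤ D)}) atTop (𝓝 0) := by
  by_cases hint : D ∈ Set.Ioo 0 1
  · have hclose : ∀ᶠ D' in 𝓝 D, ∀ a : G × G,
        |testLaw p D' a - testLaw p D a| < ε / (Fintype.card G : ℝ) ^ 2 :=
      eventually_all.2 fun a =>
        ((continuous_apply a).comp (continuous_testLaw p)).continuousAt.eventually
          (Metric.ball_mem_nhds (testLaw p D a) (by positivity))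
    have hnear : ∀ᶠ D' in 𝓝[<] D, D' ∈ C ∧ D' ∈ Set.Ioo 0 1 ∧ ∀ a : G × G,
        |testLaw p D' a - testLaw p D a| < ε / (Fintype.card G : ℝ) ^ 2 :=
      nhdsWithin_le_nhds (inter_mem hC (inter_mem (isOpen_Ioo.mem_nhds hint) hclose))
    obtain ⟨D', ⟨hD'C, hD'int, hD'close⟩, hlt⟩ := (hnear.and self_mem_nhdsWithin).exists
    have hD' : D' ∈ Set.Icc 0 1 := Set.Ioo_subset_Icc_self hD'int
    exact ⟨D', hD'C, hD', tendsto_prob_not_jointlyTypical_and_le hp hD' hlt hD'close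
      fun a h => absurd h (testLaw_pos hp hint a).ne'⟩
  · refine ⟨D, mem_of_mem_nhds hC, hD, ?_⟩
    refine (tendsto_prob_not_jointlyTypical_testLaw hp hD hε).congr fun n => ?_
    congr 1
    ext ω
    exact not_congr ⟨fun h => ⟨h, h.hammingDist_div_le_of_notMem_Ioo hD hint⟩, And.left⟩

theorem eventually_max_sub_mem_admissibleLevels (hD : 0 ≤ D) (hR : D ∈ admissibleLevels q R₀ R₁) :
    ∀ᶠ ε in 𝓝 0, max 0 (D - ε) ∈ admissibleLevels q R₀ R₁ := by
  have hcont : Continuous fun ε : ℝ => max 0 (D - ε) := by fun_prop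
  refine hcont.continuousAt.eventually_mem ((isOpen_admissibleLevels q R₀ R₁).mem_nhds ?_)
  rwa [sub_zero, max_eq_right hD]

theorem exists_isTypicalEncoder_tendsto_encoderErrorProb [Nontrivial G] (hp : ∑ g, p g = 1)
    (hq : q ∈ stdSimplex ℝ G) (hD : D ∈ Set.Icc 0 1) (hR : D ∈ admissibleLevels q R₀ R₁)
    (hM₀ : HasRate M₀ R₀) (hM₁ : HasRate M₁ R₁) (hε : 0 < ε) :
    ∃ enc : ∀ n, Encoder G n (M₀ n) (M₁ n),
      (∀ n, IsTypicalEncoder (testLaw p D) ε (enc n)) ∧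
      Tendsto (fun n => encoderErrorProb p q (enc n) D) atTop (𝓝 0) := by
  obtain ⟨D', hR', hD', hlim⟩ := exists_level_tendsto_prob_not_jointlyTypical_and_le hp hD hε
    ((isOpen_admissibleLevels q R₀ R₁).mem_nhds hR)
  choose enc henc hgood using fun n =>
    exists_isTypicalEncoder_of_priority (testLaw p D) ε (n := n) (hM₀.1 n) (hM₁.1 n)
      fun x w => (hammingDist x w : ℝ) / n ≤ D
  exact ⟨enc, henc, tendsto_encoderErrorProb hp hq hD' hR' hM₀ hM₁ (fun n => (henc n).isLaw)
    (T := fun n x => {w | JointlyTypical (testLaw p D) ε x w ∧ (hammingDist x w : ℝ) / n ≤ D})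
    hgood hlim⟩

end Achievability

end SuperpositionCoding

theorem theorem1_general {G : Type*} [AddGroup G] [Fintype G] [DecidableEq G] [Nontrivial G]
    (p q : G → ℝ) (hp : p ∈ stdSimplex ℝ G) (hq : q ∈ stdSimplex ℝ G)
    (D : ℝ) (hD0 : 0 ≤ D) (hD1 : D ≤ 1)
    (R₀ R₁ : ℝ) (M₀ M₁ : ℕ → ℕ) (hM₀ : HasRate M₀ R₀) (hM₁ : HasRate M₁ R₁)
    (hR₀ : R₀ > Real.logb 2 (Fintype.card G) - entropy (conv q (distortionLaw G D)))
    (hR : R₀ + R₁ > entropy (sourceLaw p) - entropy (distortionLaw G D)) :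
    (∃ ε₀ > 0, ∀ ε, 0 < ε → ε < ε₀ →
      ∀ enc : ∀ n, Encoder G n (M₀ n) (M₁ n),
        (∀ n, IsTypicalEncoder (testLaw p (max 0 (D - ε))) ε (enc n)) →
        Tendsto (fun n => encoderErrorProb p q (enc n) D) atTop (𝓝 0)) ∧
    (∀ ε > 0,
      (∀ enc : ∀ n, Encoder G n (M₀ n) (M₁ n),
        (∀ n, IsTypicalEncoder (testLaw p D) ε (enc n)) →
        Tendsto (fun n => encoderErrorProb p q (enc n) (D + ε)) atTop (𝓝 0)) ∧
      (∃ enc : ∀ n, Encoder G n (M₀ n) (M₁ n),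
        (∀ n, IsTypicalEncoder (testLaw p D) ε (enc n)) ∧
        Tendsto (fun n => encoderErrorProb p q (enc n) D) atTop (𝓝 0))) ∧
    (D ≤ 1 - 1 / (Fintype.card G : ℝ) →
      IsLeast (achievableInfo (sourceLaw p) D)
        (entropy (sourceLaw p) - entropy (distortionLaw G D))) := by
  have hD : D ∈ Set.Icc 0 1 := ⟨hD0, hD1⟩
  have hlevel : D ∈ admissibleLevels q R₀ R₁ := by
    rw [sourceLaw_eq_uniform hp.2, entropy_uniform] at hR
    exact ⟨hR₀, hR⟩
  obtain ⟨ε₀, hε₀, hball⟩ := Metric.eventually_nhds_iff.1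
    (eventually_max_sub_mem_admissibleLevels hD0 hlevel)
  refine ⟨⟨ε₀, hε₀, fun ε hε hlt enc henc => ?_⟩, fun ε hε => ⟨fun enc henc => ?_, ?_⟩,
    isLeast_achievableInfo hp.2 hD0⟩
  · refine tendsto_encoderErrorProb_of_isTypicalEncoder hp.2 hq
      ⟨le_max_left _ _, max_le zero_le_one ((sub_le_self D hε.le).trans hD1)⟩ (hball ?_) hM₀ hM₁ hε
      henc fun _ _ _ h => h.hammingDist_div_le_of_max hp.2 hD hε.le
    rwa [Real.dist_eq, sub_zero, abs_of_pos hε]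
  · exact tendsto_encoderErrorProb_of_isTypicalEncoder hp.2 hq hD hlevel hM₀ hM₁ hε henc
      fun _ _ _ h => h.hammingDist_div_le_add hp.2 hD hε.le
  · exact exists_isTypicalEncoder_tendsto_encoderErrorProb hp.2 hq hD hlevel hM₀ hM₁ hε

theorem theorem1 {G : Type*} [AddGroup G] [Fintype G] [DecidableEq G]
    (l : ℕ) (hl : 1 ≤ l) (hG : Fintype.card G = 2 ^ l)
    (p q : G → ℝ) (hp : p ∈ stdSimplex ℝ G) (hq : q ∈ stdSimplex ℝ G)
    (D : ℝ) (hD0 : 0 ≤ D) (hD1 : D ≤ 1)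
    (R₀ R₁ : ℝ) (M₀ M₁ : ℕ → ℕ) (hM₀ : HasRate M₀ R₀) (hM₁ : HasRate M₁ R₁)
    (hR₀ : R₀ > (l : ℝ) - entropy (conv q (distortionLaw G D)))
    (hR : R₀ + R₁ > entropy (sourceLaw p) - entropy (distortionLaw G D)) :
    -- exact constraint `D`, any encoder; the test channel is tightened by the tolerance
    (∃ ε₀ > 0, ∀ ε, 0 < ε → ε < ε₀ →
      ∀ enc : ∀ n, Encoder G n (M₀ n) (M₁ n),
        (∀ n, IsTypicalEncoder (testLaw p (max 0 (D - ε))) ε (enc n)) →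
        Tendsto (fun n => encoderErrorProb p q (enc n) D) atTop (𝓝 0)) ∧
    (∀ ε > 0,
      -- test channel with law `d` itself, any encoder; constraint `D` up to the tolerance
      (∀ enc : ∀ n, Encoder G n (M₀ n) (M₁ n),
        (∀ n, IsTypicalEncoder (testLaw p D) ε (enc n)) →
        Tendsto (fun n => encoderErrorProb p q (enc n) (D + ε)) atTop (𝓝 0)) ∧
      -- test channel with law `d` itself, suitable choice among typical pairs; constraint `D`
      (∃ enc : ∀ n, Encoder G n (M₀ n) (M₁ n),
        (∀ n, IsTypicalEncoder (testLaw p D) ε (enc n)) ∧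
        Tendsto (fun n => encoderErrorProb p q (enc n) D) atTop (𝓝 0))) ∧
    -- `H(X) - H(d)` is the value at `D` of the rate-distortion function of the source
    (D ≤ 1 - 1 / (2 : ℝ) ^ l →
      IsLeast (achievableInfo (sourceLaw p) D)
        (entropy (sourceLaw p) - entropy (distortionLaw G D))) := by
  have : Nontrivial G :=
    Fintype.one_lt_card_iff_nontrivial.1 (hG ▸ Nat.one_lt_two_pow (Nat.one_le_iff_ne_zero.1 hl))
  have hcard : (Fintype.card G : ℝ) = 2 ^ l := mod_cast hG
  simpa only [hcard] using theorem1_general p q hp hq D hD0 hD1 R₀ R₁ M₀ M₁ hM₀ hM₁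
    (by rwa [hcard, Real.logb_pow, Real.logb_self_eq_one one_lt_two, mul_one]) hR
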